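/- Let $X$ be an operator space, that is, a complex vector space with a norm on each matrix space $M_n(X)$ such that $\|x\oplus y\|=\max\{\|x\|,\|y\|\}$ and $\|\alpha x\beta\|\le\|\alpha\|\,\|x\|\,\|\beta\|$ for scalar matrices $\alpha,\beta$; rectangular matrices are normed by completing them with zeros to square ones. Write $C_2(X)=M_{2,1}(X)$ and $R_2=M_{1,2}(\mathbb C)$, and let $R_2[X]=R_2\,\hat\otimes\,X$ be the operator space projective tensor product, whose elements $e_1\otimes x+e_2\otimes y$ are written $[x\;\;y]$. The dual $X^*$ carries its standard operator space structure $M_n(X^*)=CB(X,M_n(\mathbb C))$. A linear map $P$ on an operator space $Y$ with $P^2=P$ is a complete left $M$-projection if for every $n$ and every $x\in M_n(Y)$, with $P_n$ acting entrywise, $$\|x\|=\left\|\begin{bmatrix}P_n(x)\\ x-P_n(x)\end{bmatrix}\right\|_{C_2(M_n(Y))},$$ and it is a complete right $L$-projection if the map $Y\to R_2[Y]$, $x\mapsto[\,P(x)\;\;x-P(x)\,]$, is a complete isometry. Let $P:X\to X$ be a linear map with $P^2=P$. Then $P$ is a complete left $M$-projection if and only if $P$ is bounded and its adjoint $P^*:X^*\to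 X^*$ is a complete right $L$-projection. Similarly, $P$ is a complete right $L$-projection if and only if $P$ is bounded and $P^*$ is a complete left $M$-projection. -/

import Mathlib

noncomputable section

namespace OpSp

open scoped TensorProduct Matrix.Norms.L2Operator

open Classical in
/-- The operator norm of a complex `m × n` matrix, acting between the Hilbert spaces
`ℂⁿ` and `ℂᵐ`. -/
def scalarNorm {m n : Type} [Fintype m] [Fintype n] (A : Matrix m n ℂ) : ℝ := ‖A‖

/-- The product `α x β` of a matrix `x` over a vector space with scalar matrices `α`, `β`. -/
def twoSided {X : Type*} [AddCommMonoid X] [Module ℂ X] {m k l n : Type} [Fintype k] [Fintype l]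
    (α : Matrix m k ℂ) (x : Matrix k l X) (β : Matrix l n ℂ) : Matrix m n X :=
  Matrix.of fun i j => ∑ p, ∑ q, (α i p * β q j) • x p q

/-- An (abstract) operator space: a complex vector space with norms on all the matrix spaces
`M_n(X)`, subject to Ruan's two axioms. The norm of `X` itself is the one of `M_1(X)`. -/
class OperatorSpace (X : Type*) [NormedAddCommGroup X] [NormedSpace ℂ X] where
  matNorm : ∀ {n : ℕ}, Matrix (Fin n) (Fin n) X → ℝ
  matNorm_add_le : ∀ {n : ℕ} (x y : Matrix (Fin n) (Fin n) X),
    matNorm (x + y) ≤ matNorm x + matNorm y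
  matNorm_smul : ∀ {n : ℕ} (c : ℂ) (x : Matrix (Fin n) (Fin n) X),
    matNorm (c • x) = ‖c‖ * matNorm x
  eq_zero_of_matNorm : ∀ {n : ℕ} (x : Matrix (Fin n) (Fin n) X), matNorm x = 0 → x = 0
  matNorm_one : ∀ x : X, matNorm (Matrix.of fun _ _ : Fin 1 => x) = ‖x‖
  matNorm_directSum : ∀ {m n : ℕ} (x : Matrix (Fin m) (Fin m) X) (y : Matrix (Fin n) (Fin n) X),
    matNorm (Matrix.reindex finSumFinEquiv finSumFinEquiv (Matrix.fromBlocks x 0 0 y)) =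
      max (matNorm x) (matNorm y)
  matNorm_twoSided_le : ∀ {m n : ℕ} (α : Matrix (Fin m) (Fin n) ℂ)
    (x : Matrix (Fin n) (Fin n) X) (β : Matrix (Fin n) (Fin m) ℂ),
    matNorm (twoSided α x β) ≤ scalarNorm α * matNorm x * scalarNorm β

/-- Norms of rectangular matrices over `X`, indexed by arbitrary finite types. This class only
carries data; its instances below are the standard matrix norms of an operator space, of `ℂ`, of
`M_{m,n}(X)`, of the dual `X*` and of the projective tensor product. -/
class MatrixNorms (X : Type*) where
  mnorm : ∀ {m n : Type} [Fintype m] [Fintype n], Matrix m n X → ℝ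

open MatrixNorms (mnorm)

/-- The rectangular matrix norms of an operator space: `x ∈ M_{m,n}(X)` is regarded as the corner
of the square matrix `[0 x; 0 0]` (by Ruan's axioms the enumeration of the index set is
irrelevant). -/
instance {X : Type*} [NormedAddCommGroup X] [NormedSpace ℂ X] [OperatorSpace X] :
    MatrixNorms X where
  mnorm {m n} _ _ x :=
    OperatorSpace.matNorm
      (Matrix.reindex (Fintype.equivFin (m ⊕ n)) (Fintype.equivFin (m ⊕ n))
        (Matrix.fromBlocks 0 x 0 0))

/-- The matrix norms of `ℂ`. -/
instance : MatrixNorms ℂ where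
  mnorm A := scalarNorm A

/-- The matrix norms of `M_{k,l}(X)`: a matrix of matrices is regarded as one large matrix. -/
instance {X : Type*} [MatrixNorms X] {k l : Type} [Fintype k] [Fintype l] :
    MatrixNorms (Matrix k l X) where
  mnorm {m n} _ _ x := mnorm (Matrix.comp m n k l X x)

/-- The column space `C_n(X) = M_{n,1}(X)`. -/
abbrev Col (n : ℕ) (X : Type*) := Matrix (Fin n) (Fin 1) X

/-- The row space `R_n(X) = M_{1,n}(X)`. -/
abbrev Row (n : ℕ) (X : Type*) := Matrix (Fin 1) (Fin n) X

/-- The dual operator space structure: `M_{m,n}(X*) = CB(X, M_{m,n})`, so that the norm of a matrix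
`f` of functionals is the completely bounded norm of `x ↦ [f_{ij}(x)]`. -/
instance {X : Type*} [NormedAddCommGroup X] [NormedSpace ℂ X] [MatrixNorms X] :
    MatrixNorms (StrongDual ℂ X) where
  mnorm {m n} _ _ f := sInf {C : ℝ | 0 ≤ C ∧ ∀ (r : ℕ) (x : Matrix (Fin r) (Fin r) X),
    scalarNorm (Matrix.of fun (a : Fin r × m) (b : Fin r × n) => f a.2 b.2 (x a.1 b.1)) ≤
      C * mnorm x}

/-- The operator space projective tensor product: the norm of a matrix `u` over `V ⊗ W` is the
infimum of `‖α‖ ‖v‖ ‖w‖ ‖β‖` over all factorizations `u = α (v ⊗ w) β` with `v ∈ M_p(V)` and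
`w ∈ M_q(W)`. -/
instance {V W : Type*} [AddCommMonoid V] [Module ℂ V] [MatrixNorms V]
    [AddCommMonoid W] [Module ℂ W] [MatrixNorms W] : MatrixNorms (V ⊗[ℂ] W) where
  mnorm {m n} _ _ u := sInf {r : ℝ | ∃ (p q : ℕ) (α : Matrix m (Fin p × Fin q) ℂ)
    (v : Matrix (Fin p) (Fin p) V) (w : Matrix (Fin q) (Fin q) W)
    (β : Matrix (Fin p × Fin q) n ℂ),
    u = twoSided α (Matrix.kroneckerMap (fun a b => a ⊗ₜ[ℂ] b) v w) β ∧
    r = scalarNorm α * mnorm v * mnorm w * scalarNorm β}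

/-- `R_n[X]`, the operator space projective tensor product of `R_n = R_n(ℂ)` with `X`. -/
abbrev RowProj (n : ℕ) (X : Type*) [AddCommMonoid X] [Module ℂ X] := Row n ℂ ⊗[ℂ] X

/-- The norm of a single element, regarded as a `1 × 1` matrix. -/
def elemNorm {X : Type*} [MatrixNorms X] (x : X) : ℝ := mnorm (Matrix.of fun _ _ : Fin 1 => x)

/-- `φ` is a complete isometry: all amplifications `φ_n : M_n(X) → M_n(Y)` preserve norms. -/
def IsCompleteIsometry {X Y : Type*} [AddCommMonoid X] [Module ℂ X] [MatrixNorms X]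
    [AddCommMonoid Y] [Module ℂ Y] [MatrixNorms Y] (φ : X →ₗ[ℂ] Y) : Prop :=
  ∀ (n : ℕ) (x : Matrix (Fin n) (Fin n) X), mnorm (φ.mapMatrix x) = mnorm x

/-- `P` is a left `M`-projection: `P² = P` and `‖x‖` is the norm of the column with entries `P x`
and `x - P x` in `C_2(X)`. -/
def IsLeftMProjection {X : Type*} [AddCommGroup X] [Module ℂ X] [MatrixNorms X]
    (P : X →ₗ[ℂ] X) : Prop :=
  P ∘ₗ P = P ∧ ∀ x : X, elemNorm x = elemNorm (!![P x; x - P x] : Col 2 X)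

/-- `P` is a complete left `M`-projection: each `P_n` is a left `M`-projection on `M_n(X)`. -/
def IsCompleteLeftMProjection {X : Type*} [AddCommGroup X] [Module ℂ X] [MatrixNorms X]
    (P : X →ₗ[ℂ] X) : Prop :=
  ∀ n : ℕ, IsLeftMProjection
    (P.mapMatrix : Matrix (Fin n) (Fin n) X →ₗ[ℂ] Matrix (Fin n) (Fin n) X)

/-- The map `X → R_2[X]`, `x ↦ [P x, x - P x]`. -/
def nuRow {X : Type*} [AddCommGroup X] [Module ℂ X] (P : X →ₗ[ℂ] X) : X →ₗ[ℂ] RowProj 2 X :=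
  TensorProduct.mk ℂ (Row 2 ℂ) X !![1, 0] ∘ₗ P +
    TensorProduct.mk ℂ (Row 2 ℂ) X !![0, 1] ∘ₗ (LinearMap.id - P)

/-- `P` is a complete right `L`-projection: `P² = P` and `x ↦ [P x, x - P x]` is a complete
isometry of `X` into `R_2[X]`. -/
def IsCompleteRightLProjection {X : Type*} [AddCommGroup X] [Module ℂ X] [MatrixNorms X]
    (P : X →ₗ[ℂ] X) : Prop :=
  P ∘ₗ P = P ∧ IsCompleteIsometry (nuRow P)

/-- The Banach space adjoint `P* : X* → X*`, `f ↦ f ∘ P`. -/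
def adjointMap {X : Type*} [NormedAddCommGroup X] [NormedSpace ℂ X] (P : X →L[ℂ] X) :
    StrongDual ℂ X →ₗ[ℂ] StrongDual ℂ X :=
  (ContinuousLinearMap.precomp ℂ P).toLinearMap

end OpSp

end

/-! Put Q = 1 - P. Three one-sided estimates, for rectangular matrices of every size, govern both
notions: `ColIn` (x ↦ [Px; Qx] is completely contractive into C_2), `ColOut` ([x; y] ↦ Px + Qy is
completely contractive on C_2) and `RowIn` (x ↦ [Px Qx] is completely contractive into R_2[·]). For
an idempotent, left M means `ColIn` and `ColOut` (`isCompleteLeftMProjection_iff`), and right L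
means `ColIn` and `RowIn` (`isCompleteRightLProjection_iff`). The theorem follows because passing to
adjoints preserves and reflects `ColIn` and exchanges `ColOut` with `RowIn`.

The duality runs through a trace pairing. A vector of ℂ^(k × m) is a Hilbert–Schmidt matrix, so the
cb norm of f in M_{m,n}(X*) is the least C ≥ 0 with |⟨f, αxβ⟩| ≤ C ‖α‖₂ ‖x‖ ‖β‖₂ (`CBBound`,
`cbBound_toAlg_iff`). A row and a column of scalar matrices have the same Hilbert–Schmidt norm; this
makes `ColIn` self-dual and turns functionals on R_2[V] into columns of functionals on V.

The analytic core is `exists_cb_factorization`: a contractive functional on M_{k,l}(V) is x ↦ ⟨g,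
axb⟩ with g completely contractive and ‖a‖₂ ‖b‖₂ ≤ 1 + ε. A Hahn–Banach separation in M_k × M_l
yields positive functionals dominating the given one, and a, b are square roots of their slightly
perturbed densities. Consequently norms are recovered from such pairings (`nrm_le_of_forall_pair`),
for X, R_2[X] and R_2[X*] alike.

To treat R_2[V] on the same footing, `mnorm_rowMk` rewrites the projective norm of [x₁ x₂] as the
infimum of ‖[a₁ a₂]‖ ‖w‖ ‖b‖ over factorizations x_s = a_s w b. In this form Ruan's axioms are
verified directly, and the factorizations can be moved across the pairing. -/

noncomputable section

namespace OpSp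

open scoped TensorProduct Matrix.Norms.L2Operator

open Matrix

open MatrixNorms (mnorm)

/-! ### Operator and Hilbert–Schmidt norms of scalar matrices. -/

section Scalar

variable {m n k l : Type} [Fintype m] [Fintype n] [Fintype k] [Fintype l]

/-- The Hilbert–Schmidt norm of a complex matrix. -/
def hsNorm (A : Matrix m n ℂ) : ℝ := √(∑ i, ∑ j, ‖A i j‖ ^ 2)

/-- The Euclidean norm of a complex vector. -/
def vecNorm (v : n → ℂ) : ℝ := √(∑ i, ‖v i‖ ^ 2)

theorem hsNorm_nonneg (A : Matrix m n ℂ) : 0 ≤ hsNorm A := Real.sqrt_nonneg _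

theorem vecNorm_nonneg (v : n → ℂ) : 0 ≤ vecNorm v := Real.sqrt_nonneg _

theorem hsNorm_sq (A : Matrix m n ℂ) : hsNorm A ^ 2 = ∑ i, ∑ j, ‖A i j‖ ^ 2 :=
  Real.sq_sqrt (by positivity)

theorem vecNorm_sq (v : n → ℂ) : vecNorm v ^ 2 = ∑ i, ‖v i‖ ^ 2 :=
  Real.sq_sqrt (by positivity)

theorem vecNorm_eq (v : n → ℂ) : vecNorm v = ‖(WithLp.toLp 2 v : EuclideanSpace ℂ n)‖ := by
  simp [vecNorm, EuclideanSpace.norm_eq]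

theorem hsNorm_sq_eq_sum_row (A : Matrix m n ℂ) : hsNorm A ^ 2 = ∑ i, vecNorm (A i) ^ 2 := by
  simp only [hsNorm_sq, vecNorm_sq]

theorem hsNorm_transpose (A : Matrix m n ℂ) : hsNorm Aᵀ = hsNorm A := by
  unfold hsNorm
  rw [Finset.sum_comm]
  rfl

theorem hsNorm_eq_vecNorm (A : Matrix m n ℂ) : hsNorm A = vecNorm fun p : m × n => A p.1 p.2 := by
  simp [hsNorm, vecNorm, Fintype.sum_prod_type]

theorem norm_sum_mul_le_vecNorm (u v : n → ℂ) : ‖∑ i, u i * v i‖ ≤ vecNorm u * vecNorm v := by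
  have h1 : ‖∑ i, u i * v i‖ ≤ ∑ i, ‖u i‖ * ‖v i‖ :=
    (norm_sum_le _ _).trans (by simp)
  refine h1.trans ?_
  refine abs_le_of_sq_le_sq' ?_ (mul_nonneg (vecNorm_nonneg u) (vecNorm_nonneg v)) |>.2
  rw [mul_pow, vecNorm_sq, vecNorm_sq]
  exact Finset.sum_mul_sq_le_sq_mul_sq _ _ _

theorem scalarNorm_eq_norm [DecidableEq n] (A : Matrix m n ℂ) : scalarNorm A = ‖A‖ := by
  unfold scalarNorm
  congr!

theorem scalarNorm_nonneg (A : Matrix m n ℂ) : 0 ≤ scalarNorm A := by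
  classical
  rw [scalarNorm_eq_norm]
  exact norm_nonneg A

theorem vecNorm_mulVec_le (A : Matrix m n ℂ) (v : n → ℂ) :
    vecNorm (A *ᵥ v) ≤ scalarNorm A * vecNorm v := by
  classical
  rw [scalarNorm_eq_norm, vecNorm_eq, vecNorm_eq]
  exact l2_opNorm_mulVec A (WithLp.toLp 2 v)

theorem scalarNorm_le_of_vecNorm {A : Matrix m n ℂ} {C : ℝ} (hC : 0 ≤ C)
    (h : ∀ v, vecNorm (A *ᵥ v) ≤ C * vecNorm v) : scalarNorm A ≤ C := by
  classical
  rw [scalarNorm_eq_norm, l2_opNorm_def]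
  refine ContinuousLinearMap.opNorm_le_bound _ hC fun v => ?_
  have := h v.ofLp
  rw [vecNorm_eq, vecNorm_eq] at this
  exact this

theorem norm_bilin_le (A : Matrix m n ℂ) (u : m → ℂ) (v : n → ℂ) :
    ‖∑ i, ∑ j, u i * A i j * v j‖ ≤ scalarNorm A * vecNorm u * vecNorm v := by
  have h : ∑ i, ∑ j, u i * A i j * v j = ∑ i, u i * (A *ᵥ v) i := by
    simp [mulVec, dotProduct, Finset.mul_sum, mul_assoc]
  rw [h]
  refine (norm_sum_mul_le_vecNorm _ _).trans ?_
  have := mul_le_mul_of_nonneg_left (vecNorm_mulVec_le A v) (vecNorm_nonneg u)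
  linarith

theorem scalarNorm_le_of_bilin {A : Matrix m n ℂ} {C : ℝ} (hC : 0 ≤ C)
    (h : ∀ u v, ‖∑ i, ∑ j, u i * A i j * v j‖ ≤ C * vecNorm u * vecNorm v) :
    scalarNorm A ≤ C := by
  refine scalarNorm_le_of_vecNorm hC fun v => ?_
  -- With u the conjugate of Av the form equals ‖Av‖², and one factor ‖Av‖ cancels.
  have h1 := h (star (A *ᵥ v)) v
  have h2 : ∑ i, ∑ j, (star (A *ᵥ v)) i * A i j * v j = ((vecNorm (A *ᵥ v) ^ 2 : ℝ) : ℂ) := by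
    rw [vecNorm_sq]
    push_cast
    refine Finset.sum_congr rfl fun i _ => ?_
    rw [← Complex.conj_mul']
    simp [mulVec, dotProduct, Finset.mul_sum, mul_assoc]
  have h3 : vecNorm (star (A *ᵥ v)) = vecNorm (A *ᵥ v) := by simp [vecNorm]
  rw [h2, h3, Complex.norm_real, Real.norm_of_nonneg (sq_nonneg _)] at h1
  rcases (vecNorm_nonneg (A *ᵥ v)).eq_or_lt with h0 | h0
  · rw [← h0]; exact mul_nonneg hC (vecNorm_nonneg v)
  · nlinarith

theorem scalarNorm_transpose_le (A : Matrix m n ℂ) : scalarNorm Aᵀ ≤ scalarNorm A := by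
  refine scalarNorm_le_of_bilin (scalarNorm_nonneg A) fun u v => ?_
  rw [Finset.sum_comm]
  have := norm_bilin_le A v u
  simp only [transpose_apply]
  calc _ = ‖∑ i, ∑ j, v i * A i j * u j‖ := by
        congr 1
        exact Finset.sum_congr rfl fun i _ => Finset.sum_congr rfl fun j _ => by ring
    _ ≤ _ := by linarith

theorem scalarNorm_mul_le (A : Matrix m n ℂ) (B : Matrix n k ℂ) :
    scalarNorm (A * B) ≤ scalarNorm A * scalarNorm B := by
  classical
  rw [scalarNorm_eq_norm, scalarNorm_eq_norm, scalarNorm_eq_norm]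
  exact l2_opNorm_mul A B

theorem scalarNorm_smul_le (c : ℂ) (A : Matrix m n ℂ) :
    scalarNorm (c • A) ≤ ‖c‖ * scalarNorm A := by
  classical
  rw [scalarNorm_eq_norm, scalarNorm_eq_norm]
  exact norm_smul_le c A

theorem hsNorm_smul (c : ℂ) (A : Matrix m n ℂ) : hsNorm (c • A) = ‖c‖ * hsNorm A := by
  refine (sq_eq_sq₀ (hsNorm_nonneg _) (by positivity [hsNorm_nonneg A])).1 ?_
  rw [mul_pow, hsNorm_sq, hsNorm_sq]
  simp [mul_pow, Finset.mul_sum]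

theorem hsNorm_mul_le (A : Matrix m n ℂ) (B : Matrix n k ℂ) :
    hsNorm (A * B) ≤ scalarNorm A * hsNorm B := by
  refine le_of_sq_le_sq ?_ (mul_nonneg (scalarNorm_nonneg A) (hsNorm_nonneg B))
  rw [← hsNorm_transpose, ← hsNorm_transpose B, mul_pow, hsNorm_sq_eq_sum_row,
    hsNorm_sq_eq_sum_row, Finset.mul_sum]
  refine Finset.sum_le_sum fun j _ => ?_
  rw [← mul_pow]
  exact pow_le_pow_left₀ (vecNorm_nonneg _) (vecNorm_mulVec_le A (Bᵀ j)) 2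

theorem hsNorm_mul_le' (A : Matrix m n ℂ) (B : Matrix n k ℂ) :
    hsNorm (A * B) ≤ hsNorm A * scalarNorm B := by
  rw [← hsNorm_transpose, transpose_mul, mul_comm, ← hsNorm_transpose A]
  exact (hsNorm_mul_le _ _).trans
    (mul_le_mul_of_nonneg_right (scalarNorm_transpose_le B) (hsNorm_nonneg _))

theorem scalarNorm_le_hsNorm (A : Matrix m n ℂ) : scalarNorm A ≤ hsNorm A := by
  refine scalarNorm_le_of_bilin (hsNorm_nonneg A) fun u v => ?_
  have h : vecNorm (fun p : m × n => u p.1 * v p.2) = vecNorm u * vecNorm v := by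
    rw [vecNorm, vecNorm, vecNorm, ← Real.sqrt_mul (by positivity), Fintype.sum_prod_type,
      Finset.sum_mul_sum]
    simp [mul_pow]
  have h2 := norm_sum_mul_le_vecNorm (fun p : m × n => A p.1 p.2) (fun p : m × n => u p.1 * v p.2)
  rw [h, ← hsNorm_eq_vecNorm, ← mul_assoc] at h2
  refine le_trans (le_of_eq ?_) h2
  rw [Fintype.sum_prod_type]
  congr 1
  exact Finset.sum_congr rfl fun i _ => Finset.sum_congr rfl fun j _ => by ring

theorem vecNorm_sum_elim_sq (u : m ⊕ n → ℂ) :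
    vecNorm u ^ 2 = vecNorm (u ∘ Sum.inl) ^ 2 + vecNorm (u ∘ Sum.inr) ^ 2 := by
  simp [vecNorm_sq, Fintype.sum_sum_type]

theorem hsNorm_fromCols_sq (A : Matrix m n ℂ) (B : Matrix m k ℂ) :
    hsNorm (fromCols A B) ^ 2 = hsNorm A ^ 2 + hsNorm B ^ 2 := by
  simp [hsNorm_sq, Fintype.sum_sum_type, Finset.sum_add_distrib]

theorem hsNorm_fromRows_sq (A : Matrix m n ℂ) (B : Matrix k n ℂ) :
    hsNorm (fromRows A B) ^ 2 = hsNorm A ^ 2 + hsNorm B ^ 2 := by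
  simp [hsNorm_sq, Fintype.sum_sum_type]

theorem scalarNorm_fromRows_sq_le (A : Matrix m n ℂ) (B : Matrix k n ℂ) :
    scalarNorm (fromRows A B) ^ 2 ≤ scalarNorm A ^ 2 + scalarNorm B ^ 2 := by
  have hn : (0 : ℝ) ≤ scalarNorm A ^ 2 + scalarNorm B ^ 2 := by positivity
  rw [← Real.le_sqrt (scalarNorm_nonneg _) hn]
  refine scalarNorm_le_of_vecNorm (Real.sqrt_nonneg _) fun v => ?_
  refine le_of_sq_le_sq ?_ (mul_nonneg (Real.sqrt_nonneg _) (vecNorm_nonneg v))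
  rw [vecNorm_sum_elim_sq, mul_pow, Real.sq_sqrt hn, add_mul, ← mul_pow, ← mul_pow]
  rw [fromRows_mulVec]
  exact add_le_add (pow_le_pow_left₀ (vecNorm_nonneg _) (vecNorm_mulVec_le A v) 2)
    (pow_le_pow_left₀ (vecNorm_nonneg _) (vecNorm_mulVec_le B v) 2)

theorem scalarNorm_transpose (A : Matrix m n ℂ) : scalarNorm Aᵀ = scalarNorm A :=
  le_antisymm (scalarNorm_transpose_le A) (scalarNorm_transpose_le Aᵀ)

theorem scalarNorm_fromCols_sq_le (A : Matrix m n ℂ) (B : Matrix m k ℂ) :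
    scalarNorm (fromCols A B) ^ 2 ≤ scalarNorm A ^ 2 + scalarNorm B ^ 2 := by
  rw [← scalarNorm_transpose, ← scalarNorm_transpose A, ← scalarNorm_transpose B,
    transpose_fromCols]
  exact scalarNorm_fromRows_sq_le _ _

theorem scalarNorm_fromBlocks_le {A : Matrix m n ℂ} {B : Matrix k l ℂ} {C : ℝ}
    (hA : scalarNorm A ≤ C) (hB : scalarNorm B ≤ C) :
    scalarNorm (fromBlocks A 0 0 B) ≤ C := by
  have hC := (scalarNorm_nonneg A).trans hA
  refine scalarNorm_le_of_vecNorm hC fun v => ?_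
  refine le_of_sq_le_sq ?_ (mul_nonneg hC (vecNorm_nonneg v))
  rw [vecNorm_sum_elim_sq, mul_pow, vecNorm_sum_elim_sq v, mul_add, ← mul_pow, ← mul_pow,
    fromBlocks_mulVec]
  have h1 := (vecNorm_mulVec_le A (v ∘ Sum.inl)).trans
    (mul_le_mul_of_nonneg_right hA (vecNorm_nonneg _))
  have h2 := (vecNorm_mulVec_le B (v ∘ Sum.inr)).trans
    (mul_le_mul_of_nonneg_right hB (vecNorm_nonneg _))
  simp only [zero_mulVec, add_zero, zero_add, Sum.elim_comp_inl, Sum.elim_comp_inr]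
  exact add_le_add (pow_le_pow_left₀ (vecNorm_nonneg _) h1 2)
    (pow_le_pow_left₀ (vecNorm_nonneg _) h2 2)

theorem scalarNorm_one_le [DecidableEq n] : scalarNorm (1 : Matrix n n ℂ) ≤ 1 :=
  scalarNorm_le_of_vecNorm zero_le_one fun v => by simp

/-- The scalar matrix that selects the entries listed by `e`. -/
def sel [DecidableEq k] (e : m → k) : Matrix m k ℂ := of fun i p => if p = e i then 1 else 0

theorem vecNorm_comp_le {e : m → k} (he : Function.Injective e) (v : k → ℂ) :
    vecNorm (v ∘ e) ≤ vecNorm v := by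
  classical
  refine Real.sqrt_le_sqrt ?_
  have := Finset.sum_image (s := Finset.univ) (f := fun p => ‖v p‖ ^ 2) (g := e)
    (fun a _ b _ h => he h)
  simp only [Function.comp]
  rw [← this]
  exact Finset.sum_le_sum_of_subset_of_nonneg (Finset.subset_univ _) fun _ _ _ => by positivity

theorem scalarNorm_sel_le [DecidableEq k] {e : m → k} (he : Function.Injective e) :
    scalarNorm (sel e) ≤ 1 := by
  refine scalarNorm_le_of_vecNorm zero_le_one fun v => ?_
  rw [one_mul]
  convert vecNorm_comp_le he v using 2
  ext i
  simp [sel, mulVec, dotProduct]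

/-- The amplification `A ⊗ 1`. -/
def ampl (q : Type) [DecidableEq q] (A : Matrix m n ℂ) : Matrix (m × q) (n × q) ℂ :=
  of fun a b => if a.2 = b.2 then A a.1 b.1 else 0

/-- A ⊗ 1 acts as A on each of the mutually orthogonal slices indexed by `q`. -/
theorem scalarNorm_ampl_le {q : Type} [Fintype q] [DecidableEq q] (A : Matrix m n ℂ) :
    scalarNorm (ampl q A) ≤ scalarNorm A := by
  have hs : ∀ {r : Type} [Fintype r] (v : r × q → ℂ),
      vecNorm v ^ 2 = ∑ c, vecNorm (fun a => v (a, c)) ^ 2 := by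
    intro r _ v
    simp only [vecNorm_sq, Fintype.sum_prod_type]
    exact Finset.sum_comm
  refine scalarNorm_le_of_vecNorm (scalarNorm_nonneg A) fun v => ?_
  refine le_of_sq_le_sq ?_ (mul_nonneg (scalarNorm_nonneg A) (vecNorm_nonneg v))
  rw [mul_pow, hs, hs v, Finset.mul_sum]
  refine Finset.sum_le_sum fun c _ => ?_
  rw [← mul_pow]
  refine pow_le_pow_left₀ (vecNorm_nonneg _) ?_ 2
  have : (fun a => (ampl q A *ᵥ v) (a, c)) = A *ᵥ fun a => v (a, c) := by
    funext a
    simp [ampl, mulVec, dotProduct, Fintype.sum_prod_type]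
  rw [this]
  exact vecNorm_mulVec_le A _

end Scalar

/-! ### Algebra of two-sided scalar multiplication and of the pairing. -/

section TwoSided

variable {V W : Type*} [AddCommGroup V] [Module ℂ V] [AddCommGroup W] [Module ℂ W]
variable {m n k l k' l' : Type} [Fintype k] [Fintype l]
  [Fintype k'] [Fintype l']

theorem twoSided_apply (α : Matrix m k ℂ) (x : Matrix k l V) (β : Matrix l n ℂ) (i : m) (j : n) :
    twoSided α x β i j = ∑ p, ∑ q, (α i p * β q j) • x p q := rfl

theorem twoSided_twoSided (α : Matrix m k ℂ) (α' : Matrix k k' ℂ) (x : Matrix k' l' V)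
    (β' : Matrix l' l ℂ) (β : Matrix l n ℂ) :
    twoSided α (twoSided α' x β') β = twoSided (α * α') x (β' * β) := by
  ext i j
  simp only [twoSided_apply, Finset.smul_sum, smul_smul, mul_apply]
  have : ∀ p' q', ((∑ p, α i p * α' p p') * ∑ q, β' q' q * β q j) • x p' q' =
      ∑ p, ∑ q, (α i p * β q j * (α' p p' * β' q' q)) • x p' q' := by
    intro p' q'
    rw [Finset.sum_mul_sum, Finset.sum_smul]
    refine Finset.sum_congr rfl fun p _ => ?_
    rw [Finset.sum_smul]
    exact Finset.sum_congr rfl fun q _ => by ring_nf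
  simp only [this]
  calc _ = ∑ p, ∑ p', ∑ q, ∑ q', (α i p * β q j * (α' p p' * β' q' q)) • x p' q' :=
        Finset.sum_congr rfl fun p _ => Finset.sum_comm
    _ = ∑ p', ∑ p, ∑ q', ∑ q, (α i p * β q j * (α' p p' * β' q' q)) • x p' q' := by
        rw [Finset.sum_comm]
        exact Finset.sum_congr rfl fun p' _ => Finset.sum_congr rfl fun p _ => Finset.sum_comm
    _ = _ := Finset.sum_congr rfl fun p' _ => Finset.sum_comm

theorem twoSided_add (α : Matrix m k ℂ) (x y : Matrix k l V) (β : Matrix l n ℂ) :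
    twoSided α (x + y) β = twoSided α x β + twoSided α y β := by
  ext i j
  simp [twoSided_apply, Finset.sum_add_distrib]

theorem twoSided_smul (c : ℂ) (α : Matrix m k ℂ) (x : Matrix k l V) (β : Matrix l n ℂ) :
    twoSided α (c • x) β = c • twoSided α x β := by
  ext i j
  simp [twoSided_apply, Finset.smul_sum, smul_comm c]

theorem smul_twoSided (c : ℂ) (α : Matrix m k ℂ) (x : Matrix k l V) (β : Matrix l n ℂ) :
    twoSided (c • α) x β = c • twoSided α x β := by
  ext i j
  simp [twoSided_apply, Finset.smul_sum, smul_smul, mul_assoc]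

theorem twoSided_smul_right (c : ℂ) (α : Matrix m k ℂ) (x : Matrix k l V) (β : Matrix l n ℂ) :
    twoSided α x (c • β) = c • twoSided α x β := by
  ext i j
  simp [twoSided_apply, Finset.smul_sum, smul_smul, mul_left_comm]

theorem twoSided_one [DecidableEq k] [DecidableEq l] (x : Matrix k l V) :
    twoSided 1 x 1 = x := by
  ext i j
  rw [twoSided_apply, Finset.sum_eq_single i (by simp +contextual [one_apply_ne']) (by simp),
    Finset.sum_eq_single j (by simp +contextual [one_apply_ne]) (by simp)]
  simp

theorem twoSided_map (T : V →ₗ[ℂ] W) (α : Matrix m k ℂ) (x : Matrix k l V) (β : Matrix l n ℂ) :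
    (twoSided α x β).map T = twoSided α (x.map T) β := by
  ext i j
  simp [twoSided_apply]

theorem twoSided_sel [DecidableEq k] [DecidableEq l] (e : m → k) (f : n → l) (x : Matrix k l V) :
    twoSided (sel e) x (sel f)ᵀ = x.submatrix e f := by
  ext i j
  rw [twoSided_apply, Finset.sum_eq_single (e i) (by simp +contextual [sel]) (by simp),
    Finset.sum_eq_single (f j) (by simp +contextual [sel]) (by simp)]
  simp [sel]

theorem twoSided_fromBlocks (a : Matrix m k ℂ) (a' : Matrix m k' ℂ) (x : Matrix k l V)
    (x' : Matrix k' l' V) (b : Matrix l n ℂ) (b' : Matrix l' n ℂ) :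
    twoSided (fromCols a a') (fromBlocks x 0 0 x') (fromRows b b') =
      twoSided a x b + twoSided a' x' b' := by
  ext i j
  simp [twoSided_apply, Fintype.sum_sum_type]

theorem twoSided_fromBlocks_fromBlocks {m' n' : Type} (a : Matrix m k ℂ) (a' : Matrix m' k' ℂ)
    (x : Matrix k l V) (x' : Matrix k' l' V) (b : Matrix l n ℂ) (b' : Matrix l' n' ℂ) :
    twoSided (fromBlocks a 0 0 a') (fromBlocks x 0 0 x') (fromBlocks b 0 0 b') =
      fromBlocks (twoSided a x b) 0 0 (twoSided a' x' b') := by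
  ext (i | i) (j | j) <;> simp [twoSided_apply, Fintype.sum_sum_type]

theorem twoSided_fromRows (a : Matrix m k ℂ) (a' : Matrix m k' ℂ) (x : Matrix k l V)
    (x' : Matrix k' l V) (b : Matrix l n ℂ) :
    twoSided (fromCols a a') (fromRows x x') b = twoSided a x b + twoSided a' x' b := by
  ext i j
  simp [twoSided_apply, Fintype.sum_sum_type]

variable [Fintype m] [Fintype n]

/-- The pairing `∑ fᵢⱼ(xᵢⱼ)` of a matrix of functionals with a matrix of vectors. -/
def pair (f : Matrix m n (Module.Dual ℂ V)) (x : Matrix m n V) : ℂ := ∑ i, ∑ j, f i j (x i j)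

/-- The adjoint of multiplication by scalars is multiplication by their transposes, without
conjugation, since the pairing is bilinear. This moves scalar factors between vectors and
functionals. -/
theorem pair_twoSided (f : Matrix m n (Module.Dual ℂ V)) (α : Matrix m k ℂ) (x : Matrix k l V)
    (β : Matrix l n ℂ) : pair f (twoSided α x β) = pair (twoSided αᵀ f βᵀ) x := by
  simp only [pair, twoSided_apply, map_sum, map_smul, LinearMap.sum_apply, LinearMap.smul_apply,
    transpose_apply]
  calc _ = ∑ i, ∑ p, ∑ j, ∑ q, (α i p * β q j) • f i j (x p q) :=
        Finset.sum_congr rfl fun i _ => Finset.sum_comm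
    _ = ∑ p, ∑ i, ∑ q, ∑ j, (α i p * β q j) • f i j (x p q) := by
        rw [Finset.sum_comm]
        exact Finset.sum_congr rfl fun p' _ => Finset.sum_congr rfl fun p _ => Finset.sum_comm
    _ = _ := Finset.sum_congr rfl fun p' _ => Finset.sum_comm

theorem pair_add (f : Matrix m n (Module.Dual ℂ V)) (x y : Matrix m n V) :
    pair f (x + y) = pair f x + pair f y := by
  simp [pair, Finset.sum_add_distrib]

theorem pair_smul (c : ℂ) (f : Matrix m n (Module.Dual ℂ V)) (x : Matrix m n V) :
    pair f (c • x) = c * pair f x := by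
  simp [pair, Finset.mul_sum]

theorem add_pair (f g : Matrix m n (Module.Dual ℂ V)) (x : Matrix m n V) :
    pair (f + g) x = pair f x + pair g x := by
  simp [pair, Finset.sum_add_distrib]

theorem smul_pair (c : ℂ) (f : Matrix m n (Module.Dual ℂ V)) (x : Matrix m n V) :
    pair (c • f) x = c * pair f x := by
  simp [pair, Finset.mul_sum]

theorem pair_fromRows (f : Matrix m n (Module.Dual ℂ V)) (f' : Matrix k n (Module.Dual ℂ V))
    (x : Matrix m n V) (x' : Matrix k n V) :
    pair (fromRows f f') (fromRows x x') = pair f x + pair f' x' := by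
  simp [pair, Fintype.sum_sum_type]

theorem pair_fromBlocks (f : Matrix m n (Module.Dual ℂ V)) (f' : Matrix k l (Module.Dual ℂ V))
    (x : Matrix (m ⊕ k) (n ⊕ l) V) :
    pair (fromBlocks f 0 0 f') x = pair f x.toBlocks₁₁ + pair f' x.toBlocks₂₂ := by
  simp [pair, Fintype.sum_sum_type, toBlocks₁₁, toBlocks₂₂]

end TwoSided

/-- A system of seminorms on the rectangular matrix spaces over `V` satisfying Ruan's axioms. -/
structure RuanNorm (V : Type*) [AddCommGroup V] [Module ℂ V] where
  nrm : ∀ {m n : Type} [Fintype m] [Fintype n], Matrix m n V → ℝ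
  nonneg : ∀ {m n : Type} [Fintype m] [Fintype n] (x : Matrix m n V), 0 ≤ nrm x
  add_le : ∀ {m n : Type} [Fintype m] [Fintype n] (x y : Matrix m n V),
    nrm (x + y) ≤ nrm x + nrm y
  smul_le : ∀ {m n : Type} [Fintype m] [Fintype n] (c : ℂ) (x : Matrix m n V),
    nrm (c • x) ≤ ‖c‖ * nrm x
  twoSided_le : ∀ {m n k l : Type} [Fintype m] [Fintype n] [Fintype k] [Fintype l]
    (α : Matrix m k ℂ) (x : Matrix k l V) (β : Matrix l n ℂ),
    nrm (twoSided α x β) ≤ scalarNorm α * nrm x * scalarNorm β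
  fromBlocks_le : ∀ {m n k l : Type} [Fintype m] [Fintype n] [Fintype k] [Fintype l]
    (x : Matrix m n V) (y : Matrix k l V), nrm (fromBlocks x 0 0 y) ≤ max (nrm x) (nrm y)

/-! ### Densities of positive functionals on matrix algebras. -/

section Trace

open scoped ComplexOrder

variable {k m : Type} [Fintype k] [Fintype m]

theorem trace_mul_conjTranspose_self (A : Matrix k m ℂ) :
    (A * Aᴴ).trace = ((hsNorm A ^ 2 : ℝ) : ℂ) := by
  rw [hsNorm_sq]
  push_cast
  simp [trace, mul_apply, Complex.mul_conj']

/-- A functional on `M_k` that is positive on rank one projections is, up to a small faithful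
perturbation, given by a density `aᴴ * a` with `a` invertible. -/
theorem exists_density [DecidableEq k] (L : Matrix k k ℂ →ₗ[ℂ] ℂ)
    (hL : ∀ v : k → ℂ, 0 ≤ (L (vecMulVec v (star v))).re) {δ : ℝ} (hδ : 0 < δ) :
    ∃ a : Matrix k k ℂ, (∃ a' : Matrix k k ℂ, a * a' = 1 ∧ a' * a = 1) ∧
      ∀ {m : Type} [Fintype m] (α : Matrix k m ℂ),
        hsNorm (a * α) ^ 2 = 2 * (L (α * αᴴ)).re + δ * hsNorm α ^ 2 := by
  -- ρ represents `L` through the trace. As `L` need not be Hermitian, ρ + ρᴴ is used below, which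
  -- accounts for the factor 2 in front of the real part.
  set ρ : Matrix k k ℂ := of fun i j => L (single j i 1) with hρ
  have hLtr : ∀ A, L A = (ρ * A).trace := by
    intro A
    conv_lhs => rw [matrix_eq_sum_single A]
    simp only [map_sum, trace, diag, mul_apply, hρ, of_apply]
    rw [Finset.sum_comm]
    refine Finset.sum_congr rfl fun j _ => Finset.sum_congr rfl fun i _ => ?_
    rw [← mul_one (A i j), ← smul_eq_mul, ← smul_single, map_smul]
    simp [mul_comm]
  have hherm : ∀ {m : Type} [Fintype m] (α : Matrix k m ℂ),
      ((ρ + ρᴴ) * (α * αᴴ)).trace = ((2 * (L (α * αᴴ)).re : ℝ) : ℂ) := by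
    intro m _ α
    have h : (ρᴴ * (α * αᴴ)).trace = star (L (α * αᴴ)) := by
      rw [hLtr, ← trace_conjTranspose, conjTranspose_mul, trace_mul_comm ρᴴ]
      simp
    rw [Matrix.add_mul, trace_add, h, ← hLtr]
    apply Complex.ext <;> simp [two_mul]
  have hpsd : (ρ + ρᴴ).PosSemidef := by
    refine PosSemidef.of_dotProduct_mulVec_nonneg ?_ fun v => ?_
    · simp [IsHermitian, add_comm]
    · have h1 := hherm (replicateCol Unit v)
      have h2 : replicateCol Unit v * (replicateCol Unit v)ᴴ = vecMulVec v (star v) := by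
        rw [vecMulVec_eq Unit]; simp
      have h3 : star v ⬝ᵥ ((ρ + ρᴴ) *ᵥ v) = ((ρ + ρᴴ) * vecMulVec v (star v)).trace := by
        rw [mul_vecMulVec, trace_vecMulVec, dotProduct_comm]
      rw [h3, ← h2, h1, h2]
      exact_mod_cast mul_nonneg zero_le_two (hL v)
  -- The multiple δ of the identity makes the density definite, hence `a` invertible.
  have hpd : (ρ + ρᴴ + (δ : ℂ) • (1 : Matrix k k ℂ)).PosDef :=
    PosDef.posSemidef_add hpsd (PosDef.one.smul (by exact_mod_cast hδ))
  obtain ⟨a, ha⟩ : ∃ a : Matrix k k ℂ, ρ + ρᴴ + (δ : ℂ) • (1 : Matrix k k ℂ) = aᴴ * a := by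
    open scoped MatrixOrder in
    exact CStarAlgebra.nonneg_iff_eq_star_mul_self.1 (nonneg_iff_posSemidef.2 hpd.posSemidef)
  refine ⟨a, ⟨a⁻¹, ?_⟩, fun {m} _ α => ?_⟩
  · have hu : IsUnit a.det := by
      have := (isUnit_iff_isUnit_det _).1 hpd.isUnit
      rw [ha, det_mul] at this
      exact isUnit_of_mul_isUnit_right this
    exact ⟨mul_nonsing_inv a hu, nonsing_inv_mul a hu⟩
  · have h := trace_mul_conjTranspose_self (a * α)
    have h2 : (a * α * (a * α)ᴴ).trace = (aᴴ * a * (α * αᴴ)).trace := by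
      rw [conjTranspose_mul, ← Matrix.mul_assoc, trace_mul_comm]
      simp [Matrix.mul_assoc]
    rw [h2, ← ha, Matrix.add_mul, trace_add, hherm, smul_mul, Matrix.one_mul, trace_smul,
      trace_mul_conjTranspose_self] at h
    have := congrArg Complex.re h
    simp only [smul_eq_mul, ← Complex.ofReal_mul, ← Complex.ofReal_add, Complex.ofReal_re] at this
    exact this.symm

theorem smul_mul_conjTranspose (c : ℝ) {k : Type} (α : Matrix k m ℂ) :
    ((c : ℂ) • α) * ((c : ℂ) • α)ᴴ = (c ^ 2 : ℝ) • (α * αᴴ) := by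
  ext i j
  simp [mul_apply, Finset.mul_sum]
  refine Finset.sum_congr rfl fun p _ => by ring

theorem smul_conjTranspose_mul (c : ℝ) {l : Type} (β : Matrix m l ℂ) :
    ((c : ℂ) • β)ᴴ * ((c : ℂ) • β) = (c ^ 2 : ℝ) • (βᴴ * β) := by
  ext i j
  simp [mul_apply, Finset.mul_sum]
  refine Finset.sum_congr rfl fun p _ => by ring

end Trace

/-! ### Factorization of functionals on matrix spaces. -/

namespace RuanNorm

variable {V : Type*} [AddCommGroup V] [Module ℂ V] (N : RuanNorm V)
variable {m n k l : Type} [Fintype m] [Fintype n] [Fintype k] [Fintype l]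

theorem nrm_zero : N.nrm (0 : Matrix m n V) = 0 := by
  have := N.smul_le 0 (0 : Matrix m n V)
  simp only [smul_zero, norm_zero, zero_mul] at this
  exact le_antisymm this (N.nonneg _)

theorem nrm_smul (c : ℂ) (x : Matrix m n V) : N.nrm (c • x) = ‖c‖ * N.nrm x := by
  refine le_antisymm (N.smul_le c x) ?_
  rcases eq_or_ne c 0 with rfl | hc
  · simpa using N.nonneg _
  · have := N.smul_le c⁻¹ (c • x)
    rw [smul_smul, inv_mul_cancel₀ hc, one_smul, norm_inv] at this
    rwa [inv_mul_eq_div, le_div_iff₀ (norm_pos_iff.2 hc), mul_comm] at this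

theorem twoSided_le_of_le_one {α : Matrix m k ℂ} (x : Matrix k l V) {β : Matrix l n ℂ}
    (hα : scalarNorm α ≤ 1) (hβ : scalarNorm β ≤ 1) : N.nrm (twoSided α x β) ≤ N.nrm x := by
  refine (N.twoSided_le α x β).trans ?_
  calc _ ≤ 1 * N.nrm x * 1 := by
        gcongr
        exacts [scalarNorm_nonneg β, by simpa using N.nonneg x, N.nonneg x]
    _ = _ := by simp

theorem nrm_submatrix_le (x : Matrix k l V) {e : m → k} {f : n → l} (he : Function.Injective e)
    (hf : Function.Injective f) : N.nrm (x.submatrix e f) ≤ N.nrm x := by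
  classical
  rw [← twoSided_sel]
  refine N.twoSided_le_of_le_one x (scalarNorm_sel_le he) ?_
  rw [scalarNorm_transpose]
  exact scalarNorm_sel_le hf

theorem nrm_submatrix_equiv (x : Matrix k l V) (e : m ≃ k) (f : n ≃ l) :
    N.nrm (x.submatrix e f) = N.nrm x := by
  refine le_antisymm (N.nrm_submatrix_le x e.injective f.injective) ?_
  have := N.nrm_submatrix_le (x.submatrix e f) e.symm.injective f.symm.injective
  simpa using this

theorem nrm_fromBlocks_corner_le (x : Matrix m n V) :
    N.nrm (fromBlocks (0 : Matrix m k V) x (0 : Matrix l k V) 0) ≤ N.nrm x := by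
  have h : fromBlocks (0 : Matrix m k V) x (0 : Matrix l k V) 0 =
      (fromBlocks x 0 0 (0 : Matrix l k V)).submatrix id Sum.swap := by
    ext (i | i) (j | j) <;> rfl
  rw [h]
  refine (N.nrm_submatrix_le _ Function.injective_id
    Sum.swap_leftInverse.injective).trans ((N.fromBlocks_le _ _).trans ?_)
  rw [N.nrm_zero]
  exact max_le le_rfl (N.nonneg x)

/-- The convex set of Gram pairs `(α αᴴ, βᴴ β)` with `Re F(α x β) ≥ 1` for some `x` in the unit
ball. -/
def gramSet (F : Matrix k l V →ₗ[ℂ] ℂ) : Set (Matrix k k ℂ × Matrix l l ℂ) :=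
  {A | ∃ (m n : Type) (_ : Fintype m) (_ : Fintype n) (α : Matrix k m ℂ) (x : Matrix m n V)
    (β : Matrix n l ℂ), N.nrm x ≤ 1 ∧ 1 ≤ (F (twoSided α x β)).re ∧ A = (α * αᴴ, βᴴ * β)}

/-- Convex combinations are realized by direct sums: with α, β scaled by √s and √t and x ⊕ x' in the
middle, both the Gram matrices and the values of `F` add with weights s and t. The axiom on direct
sums keeps x ⊕ x' in the unit ball. -/
theorem convex_gramSet {k l : Type} (F : Matrix k l V →ₗ[ℂ] ℂ) : Convex ℝ (N.gramSet F) := by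
  rintro _ ⟨m, n, _, _, α, x, β, hx, hF, rfl⟩ _
    ⟨m', n', _, _, α', x', β', hx', hF', rfl⟩ s t hs ht hst
  refine ⟨m ⊕ m', n ⊕ n', inferInstance, inferInstance,
    fromCols (((√s : ℝ) : ℂ) • α) (((√t : ℝ) : ℂ) • α'), fromBlocks x 0 0 x',
    fromRows (((√s : ℝ) : ℂ) • β) (((√t : ℝ) : ℂ) • β'),
    (N.fromBlocks_le x x').trans (max_le hx hx'), ?_, ?_⟩
  · rw [twoSided_fromBlocks]
    simp only [smul_twoSided, twoSided_smul_right, smul_smul, ← Complex.ofReal_mul,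
      Real.mul_self_sqrt hs, Real.mul_self_sqrt ht, map_add, map_smul]
    simp only [smul_eq_mul, Complex.add_re, Complex.re_ofReal_mul]
    nlinarith
  · rw [conjTranspose_fromCols_eq_fromRows_conjTranspose, fromCols_mul_fromRows,
      conjTranspose_fromRows_eq_fromCols_conjTranspose, fromCols_mul_fromRows]
    simp only [smul_mul_conjTranspose, smul_conjTranspose_mul, Real.sq_sqrt hs, Real.sq_sqrt ht]
    rfl

/-- On the Gram set 1 ≤ ‖α‖ ‖β‖, so the arithmetic–geometric mean inequality gives ‖α αᴴ‖ + ‖βᴴ β‖ =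
‖α‖² + ‖β‖² ≥ 2. -/
theorem disjoint_gramSet [DecidableEq k] [DecidableEq l] {F : Matrix k l V →ₗ[ℂ] ℂ}
    (hF : ∀ x, ‖F x‖ ≤ N.nrm x) :
    Disjoint {A : Matrix k k ℂ × Matrix l l ℂ | ‖A.1‖ + ‖A.2‖ < 2} (N.gramSet F) := by
  rw [Set.disjoint_left]
  rintro _ hA ⟨m, n, _, _, α, x, β, hx, h1, rfl⟩
  classical
  have h2 : (1 : ℝ) ≤ scalarNorm α * 1 * scalarNorm β := by
    refine h1.trans ((Complex.re_le_norm _).trans ((hF _).trans ((N.twoSided_le α x β).trans ?_)))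
    gcongr
    · exact scalarNorm_nonneg β
    · exact scalarNorm_nonneg α
  have h3 : ‖α * αᴴ‖ = scalarNorm α * scalarNorm α := by
    have := l2_opNorm_conjTranspose_mul_self αᴴ
    rw [conjTranspose_conjTranspose, l2_opNorm_conjTranspose] at this
    rw [this, scalarNorm_eq_norm]
  have h4 : ‖βᴴ * β‖ = scalarNorm β * scalarNorm β := by
    rw [l2_opNorm_conjTranspose_mul_self, scalarNorm_eq_norm]
  simp only [Set.mem_ofPred_eq, h3, h4] at hA
  nlinarith [sq_nonneg (scalarNorm α - scalarNorm β)]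

/-- The separating functional of the two convex sets splits into its components on M_k and M_l.
Positivity comes from stability of the Gram set under adding positive rank one matrices,
normalization from the size of the open set. -/
theorem exists_positive_functionals [DecidableEq k] [DecidableEq l]
    {F : Matrix k l V →ₗ[ℂ] ℂ} (hF : ∀ x, ‖F x‖ ≤ N.nrm x) :
    ∃ (L : Matrix k k ℂ →ₗ[ℂ] ℂ) (M : Matrix l l ℂ →ₗ[ℂ] ℂ),
      (∀ v : k → ℂ, 0 ≤ (L (vecMulVec v (star v))).re) ∧
      (∀ v : l → ℂ, 0 ≤ (M (vecMulVec v (star v))).re) ∧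
      2 * (L 1).re ≤ 1 ∧ 2 * (M 1).re ≤ 1 ∧
      ∀ A ∈ N.gramSet F, 1 ≤ (L A.1).re + (M A.2).re := by
  rcases (N.gramSet F).eq_empty_or_nonempty with h0 | ⟨A₀, hA₀⟩
  · exact ⟨0, 0, by simp, by simp, by simp, by simp, by simp [h0]⟩
  have hopen : IsOpen {A : Matrix k k ℂ × Matrix l l ℂ | ‖A.1‖ + ‖A.2‖ < 2} :=
    isOpen_lt (by fun_prop) continuous_const
  have hconv : Convex ℝ {A : Matrix k k ℂ × Matrix l l ℂ | ‖A.1‖ + ‖A.2‖ < 2} := by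
    have h1 : ConvexOn ℝ Set.univ fun A : Matrix k k ℂ × Matrix l l ℂ => ‖A.1‖ + ‖A.2‖ :=
      ((convexOn_univ_norm (E := Matrix k k ℂ)).comp_linearMap (LinearMap.fst ℝ _ _)).add
        ((convexOn_univ_norm (E := Matrix l l ℂ)).comp_linearMap (LinearMap.snd ℝ _ _))
    simpa using h1.convex_lt 2
  obtain ⟨f, u, hf1, hf2⟩ := RCLike.geometric_hahn_banach_open (𝕜 := ℂ) hconv hopen
    (N.convex_gramSet F) (N.disjoint_gramSet hF)
  have hu : 0 < u := by simpa using hf1 0 (by simp)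
  set L : Matrix k k ℂ →ₗ[ℂ] ℂ := f.toLinearMap ∘ₗ LinearMap.inl ℂ _ _ with hLdef
  set M : Matrix l l ℂ →ₗ[ℂ] ℂ := f.toLinearMap ∘ₗ LinearMap.inr ℂ _ _ with hMdef
  have hsum : ∀ A, f A = L A.1 + M A.2 := fun A => by
    simp [hLdef, hMdef, ← map_add]
  have hre : ∀ z : ℂ, RCLike.re z = z.re := fun _ => rfl
  simp only [hsum, hre, Complex.add_re] at hf1 hf2
  -- Appending columns √t v and rows √t wᴴ that meet a zero block of vectors leaves the value of `F`
  -- unchanged and adds t v vᴴ and t w wᴴ to the Gram pair.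
  have hadd : ∀ (v : k → ℂ) (w : l → ℂ) (t : ℝ), 0 ≤ t → ∃ c : ℝ,
      0 ≤ c + t * ((L (vecMulVec v (star v))).re + (M (vecMulVec w (star w))).re) ∧
        c = (L A₀.1).re + (M A₀.2).re := by
    intro v w t ht
    obtain ⟨m, n, _, _, α, x, β, hx, h1, rfl⟩ := hA₀
    refine ⟨_, ?_, rfl⟩
    have hmem : (α * αᴴ + t • vecMulVec v (star v), βᴴ * β + t • vecMulVec w (star w)) ∈
        N.gramSet F := by
      refine ⟨m ⊕ Unit, n ⊕ Unit, inferInstance, inferInstance,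
        fromCols α (((√t : ℝ) : ℂ) • replicateCol Unit v), fromBlocks x 0 0 0,
        fromRows β (((√t : ℝ) : ℂ) • (replicateCol Unit w)ᴴ),
        (N.fromBlocks_le x 0).trans (max_le hx (by rw [N.nrm_zero]; exact zero_le_one)), ?_, ?_⟩
      · rw [twoSided_fromBlocks]
        have : ∀ (a : Matrix k Unit ℂ) (b : Matrix Unit l ℂ),
            twoSided a (0 : Matrix Unit Unit V) b = 0 := fun a b => by
          ext; simp [twoSided_apply]
        rw [this, add_zero]
        exact h1
      · rw [conjTranspose_fromCols_eq_fromRows_conjTranspose, fromCols_mul_fromRows,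
          conjTranspose_fromRows_eq_fromCols_conjTranspose, fromCols_mul_fromRows]
        simp only [smul_mul_conjTranspose, smul_conjTranspose_mul, Real.sq_sqrt ht,
          conjTranspose_conjTranspose]
        rw [vecMulVec_eq Unit, vecMulVec_eq Unit]
        simp
    have h3 := hf2 _ hmem
    have hreal : ∀ {q : Type} [Fintype q] (T : Matrix q q ℂ →ₗ[ℂ] ℂ) (B : Matrix q q ℂ),
        (T (t • B)).re = t * (T B).re := fun T B => by
      rw [← Complex.coe_smul, map_smul]; simp
    simp only [map_add, Complex.add_re, hreal] at h3
    linarith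
  have hpos : ∀ {c s : ℝ}, (∀ t : ℝ, 0 ≤ t → 0 ≤ c + t * s) → 0 ≤ s := by
    intro c s h
    by_contra! hs
    have h1 := h ((|c| + 1) / (-s)) (div_nonneg (by positivity) (by linarith))
    rw [div_mul_eq_mul_div, mul_div_assoc, div_neg, div_self hs.ne] at h1
    linarith [le_abs_self c]
  -- Otherwise (u / Re T(1)) · 1 would have norm below 2 while the real part of `T` there equals
  -- `u`.
  have hscale : ∀ {q : Type} [Fintype q] [DecidableEq q] (T : Matrix q q ℂ →ₗ[ℂ] ℂ),
      (∀ B, ‖B‖ < 2 → (T B).re < u) → 2 * (T 1).re ≤ u := by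
    intro q _ _ T hT
    by_contra! hc
    have hT1 : 0 < (T 1).re := by linarith
    have h1 := hT (((u / (T 1).re : ℝ) : ℂ) • 1) ?_
    · rw [map_smul, smul_eq_mul, Complex.re_ofReal_mul, div_mul_cancel₀ _ hT1.ne'] at h1
      exact lt_irrefl _ h1
    · refine (norm_smul_le _ _).trans_lt ?_
      have h2 : ‖(1 : Matrix q q ℂ)‖ ≤ 1 := by
        rw [← scalarNorm_eq_norm]; exact scalarNorm_one_le
      rw [Complex.norm_real, Real.norm_of_nonneg (by positivity)]
      calc _ ≤ u / (T 1).re * 1 := by gcongr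
        _ < 2 := by rw [mul_one, div_lt_iff₀ hT1]; linarith
  have hinv : ∀ z : ℂ, (((u⁻¹ : ℝ) : ℂ) * z).re = u⁻¹ * z.re := fun z => Complex.re_ofReal_mul _ _
  refine ⟨((u⁻¹ : ℝ) : ℂ) • L, ((u⁻¹ : ℝ) : ℂ) • M, fun v => ?_, fun w => ?_,
    ?_, ?_, fun A hA => ?_⟩
  · rw [LinearMap.smul_apply, smul_eq_mul, hinv]
    refine mul_nonneg (inv_nonneg.2 hu.le) (hpos (c := (L A₀.1).re + (M A₀.2).re) fun t ht => ?_)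
    obtain ⟨c, hc, rfl⟩ := hadd v 0 t ht
    simpa using hc
  · rw [LinearMap.smul_apply, smul_eq_mul, hinv]
    refine mul_nonneg (inv_nonneg.2 hu.le) (hpos (c := (L A₀.1).re + (M A₀.2).re) fun t ht => ?_)
    obtain ⟨c, hc, rfl⟩ := hadd 0 w t ht
    simpa using hc
  · have := hscale L fun B hB => by simpa using hf1 (B, 0) (by simpa using hB)
    rw [LinearMap.smul_apply, smul_eq_mul, hinv, mul_left_comm, inv_mul_le_iff₀ hu]
    simpa using this
  · have := hscale M fun B hB => by simpa using hf1 (0, B) (by simpa using hB)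
    rw [LinearMap.smul_apply, smul_eq_mul, hinv, mul_left_comm, inv_mul_le_iff₀ hu]
    simpa using this
  · rw [LinearMap.smul_apply, smul_eq_mul, hinv, LinearMap.smul_apply, smul_eq_mul, hinv,
      ← mul_add, inv_mul_eq_div, one_le_div hu]
    exact hf2 A hA

theorem hsNorm_one_sq [DecidableEq k] : hsNorm (1 : Matrix k k ℂ) ^ 2 = Fintype.card k := by
  have : ∀ i j : k, ‖(1 : Matrix k k ℂ) i j‖ ^ 2 = if i = j then 1 else 0 := by
    intro i j
    by_cases h : i = j <;> simp [one_apply, h]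
  simp [hsNorm_sq, this]

theorem hsNorm_conjTranspose (A : Matrix m n ℂ) : hsNorm Aᴴ = hsNorm A := by
  rw [← hsNorm_transpose A]
  simp [hsNorm]

/-- The state bound: a contractive functional on `M_{k,l}(V)` is dominated by a pair of faithful
densities. -/
theorem exists_density_bound [DecidableEq k] [DecidableEq l] {F : Matrix k l V →ₗ[ℂ] ℂ}
    (hF : ∀ x, ‖F x‖ ≤ N.nrm x) {ε : ℝ} (hε : 0 < ε) :
    ∃ (a a' : Matrix k k ℂ) (b b' : Matrix l l ℂ), a' * a = 1 ∧ a * a' = 1 ∧ b * b' = 1 ∧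
      b' * b = 1 ∧ hsNorm a ^ 2 ≤ 1 + ε ∧ hsNorm b ^ 2 ≤ 1 + ε ∧
      ∀ {m n : Type} [Fintype m] [Fintype n] (α : Matrix k m ℂ) (x : Matrix m n V)
        (β : Matrix n l ℂ),
        ‖F (twoSided α x β)‖ ≤ hsNorm (a * α) * N.nrm x * hsNorm (β * b) := by
  obtain ⟨L, M, hL, hM, hL1, hM1, hLM⟩ := N.exists_positive_functionals hF
  -- Since ‖1‖₂² is the size of the matrix, this δ costs at most ε in both Hilbert–Schmidt norms.
  set δ : ℝ := ε / (Fintype.card k + Fintype.card l + 1) with hδdef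
  have hδ : 0 < δ := by positivity
  have hδε : δ * (Fintype.card k + Fintype.card l + 1) = ε := by
    rw [hδdef]; field_simp
  have hk : (0 : ℝ) ≤ δ * Fintype.card k := by positivity
  have hl : (0 : ℝ) ≤ δ * Fintype.card l := by positivity
  obtain ⟨a, ⟨a', h1, h2⟩, ha⟩ := exists_density L hL hδ
  obtain ⟨c, ⟨c', h3, h4⟩, hc⟩ := exists_density M hM hδ
  have hb : ∀ {n : Type} [Fintype n] (β : Matrix n l ℂ),
      hsNorm (β * cᴴ) ^ 2 = 2 * (M (βᴴ * β)).re + δ * hsNorm β ^ 2 := by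
    intro n _ β
    have := hc βᴴ
    rwa [conjTranspose_conjTranspose, hsNorm_conjTranspose, ← hsNorm_conjTranspose,
      conjTranspose_mul, conjTranspose_conjTranspose] at this
  refine ⟨a, a', cᴴ, c'ᴴ, h2, h1, ?_, ?_, ?_, ?_, ?_⟩
  · rw [← conjTranspose_mul, h4, conjTranspose_one]
  · rw [← conjTranspose_mul, h3, conjTranspose_one]
  · have := ha (1 : Matrix k k ℂ)
    rw [Matrix.mul_one, conjTranspose_one, Matrix.mul_one, hsNorm_one_sq] at this
    rw [this]
    nlinarith
  · have := hb (1 : Matrix l l ℂ)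
    rw [Matrix.one_mul, conjTranspose_one, Matrix.mul_one, hsNorm_one_sq] at this
    rw [this]
    nlinarith
  have key1 : ∀ {m n : Type} [Fintype m] [Fintype n] (α : Matrix k m ℂ) (x : Matrix m n V)
      (β : Matrix n l ℂ), N.nrm x ≤ 1 →
      2 * (F (twoSided α x β)).re ≤ hsNorm (a * α) ^ 2 + hsNorm (β * cᴴ) ^ 2 := by
    intro m n _ _ α x β hx
    set t := (F (twoSided α x β)).re with ht
    rcases le_or_gt t 0 with h0 | h0
    · nlinarith [sq_nonneg (hsNorm (a * α)), sq_nonneg (hsNorm (β * cᴴ))]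
    -- Scaling α and β by t^(-1/2) each makes the value of `F` have real part exactly 1, so the Gram
    -- pair becomes admissible.
    have hs : (√t)⁻¹ ^ 2 = t⁻¹ := by rw [inv_pow, Real.sq_sqrt h0.le]
    have hmem := hLM _ ⟨m, n, inferInstance, inferInstance, (((√t)⁻¹ : ℝ) : ℂ) • α, x,
      (((√t)⁻¹ : ℝ) : ℂ) • β, hx, ?_, rfl⟩
    · simp only [smul_mul_conjTranspose, smul_conjTranspose_mul, hs] at hmem
      rw [← Complex.coe_smul, ← Complex.coe_smul, map_smul, map_smul, smul_eq_mul, smul_eq_mul,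
        Complex.re_ofReal_mul, Complex.re_ofReal_mul, ← mul_add, inv_mul_eq_div,
        one_le_div h0] at hmem
      rw [ha, hb]
      nlinarith [mul_nonneg hδ.le (sq_nonneg (hsNorm α)), mul_nonneg hδ.le (sq_nonneg (hsNorm β))]
    · rw [smul_twoSided, twoSided_smul_right, smul_smul, ← Complex.ofReal_mul, ← sq, hs, map_smul,
        smul_eq_mul, Complex.re_ofReal_mul, ← ht, inv_mul_cancel₀ h0.ne']
  -- Replacing α by rα gives a quadratic in r that is nonnegative for all real r; its discriminant
  -- turns the sum of squares into a product.
  have key2 : ∀ {m n : Type} [Fintype m] [Fintype n] (α : Matrix k m ℂ) (x : Matrix m n V)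
      (β : Matrix n l ℂ), N.nrm x ≤ 1 →
      (F (twoSided α x β)).re ≤ hsNorm (a * α) * hsNorm (β * cᴴ) := by
    intro m n _ _ α x β hx
    have hd : discrim (hsNorm (a * α) ^ 2) (-2 * (F (twoSided α x β)).re) (hsNorm (β * cᴴ) ^ 2)
        ≤ 0 := by
      refine discrim_le_zero fun r => ?_
      have := key1 ((r : ℂ) • α) x β hx
      rw [smul_twoSided, map_smul, smul_eq_mul, Complex.re_ofReal_mul, Matrix.mul_smul, hsNorm_smul,
        mul_pow, Complex.norm_real, Real.norm_eq_abs, sq_abs] at this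
      linarith
    refine le_of_sq_le_sq ?_ (mul_nonneg (hsNorm_nonneg _) (hsNorm_nonneg _))
    rw [discrim] at hd
    rw [mul_pow]
    linarith
  have key3 : ∀ {m n : Type} [Fintype m] [Fintype n] (α : Matrix k m ℂ) (x : Matrix m n V)
      (β : Matrix n l ℂ), N.nrm x ≤ 1 →
      ‖F (twoSided α x β)‖ ≤ hsNorm (a * α) * hsNorm (β * cᴴ) := by
    intro m n _ _ α x β hx
    -- Multiplying α by the phase conj(z)/|z| makes the value real and leaves the Hilbert–Schmidt
    -- norm alone.
    set z := F (twoSided α x β) with hz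
    rcases eq_or_ne z 0 with h0 | h0
    · rw [h0, norm_zero]
      exact mul_nonneg (hsNorm_nonneg _) (hsNorm_nonneg _)
    · have h5 := key2 ((star z / ‖z‖ : ℂ) • α) x β hx
      have h6 : ‖(star z / ‖z‖ : ℂ)‖ = 1 := by
        rw [norm_div, norm_star, Complex.norm_real, norm_norm, div_self (norm_ne_zero_iff.2 h0)]
      have h7 : (star z / ‖z‖ : ℂ) * z = (‖z‖ : ℝ) := by
        have : (‖z‖ : ℂ) ≠ 0 := by exact_mod_cast norm_ne_zero_iff.2 h0
        rw [div_mul_eq_mul_div, div_eq_iff this, ← sq]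
        exact Complex.conj_mul' z
      rwa [smul_twoSided, map_smul, smul_eq_mul, ← hz, h7, Complex.ofReal_re, Matrix.mul_smul,
        hsNorm_smul, h6, one_mul] at h5
  intro m n _ _ α x β
  have hnn := mul_nonneg (hsNorm_nonneg (a * α)) (hsNorm_nonneg (β * cᴴ))
  -- The norm is only a seminorm, so x is divided by some r > ‖x‖ rather than by ‖x‖.
  have key4 : ∀ r : ℝ, N.nrm x < r →
      ‖F (twoSided α x β)‖ ≤ r * (hsNorm (a * α) * hsNorm (β * cᴴ)) := by
    intro r hr
    have hr0 : 0 < r := (N.nonneg x).trans_lt hr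
    have := key3 α (((r⁻¹ : ℝ) : ℂ) • x) β ?_
    · rw [twoSided_smul, map_smul, norm_smul, Complex.norm_real,
        Real.norm_of_nonneg (inv_nonneg.2 hr0.le), inv_mul_le_iff₀ hr0] at this
      exact this
    · rw [N.nrm_smul, Complex.norm_real, Real.norm_of_nonneg (inv_nonneg.2 hr0.le),
        inv_mul_le_iff₀ hr0, mul_one]
      exact hr.le
  have key5 : ‖F (twoSided α x β)‖ ≤ N.nrm x * (hsNorm (a * α) * hsNorm (β * cᴴ)) := by
    refine ge_of_tendsto (x := nhdsWithin (N.nrm x) (Set.Ioi (N.nrm x)))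
      (f := fun r => r * (hsNorm (a * α) * hsNorm (β * cᴴ))) ?_
      (Filter.eventually_of_mem self_mem_nhdsWithin fun r hr => key4 r hr)
    exact (Continuous.tendsto (by fun_prop) _).mono_left nhdsWithin_le_nhds
  linarith

/-- The completely bounded norm of the matrix `f` of functionals is at most `C`, expressed through
the pairing with `α x β`. -/
def CBBound (f : Matrix m n (Module.Dual ℂ V)) (C : ℝ) : Prop :=
  ∀ ⦃k l : Type⦄ [Fintype k] [Fintype l] (α : Matrix m k ℂ) (x : Matrix k l V)
    (β : Matrix l n ℂ), ‖pair f (twoSided α x β)‖ ≤ C * (hsNorm α * N.nrm x * hsNorm β)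

theorem pair_of_linearMap [DecidableEq k] [DecidableEq l] (F : Matrix k l V →ₗ[ℂ] ℂ)
    (x : Matrix k l V) :
    pair (of fun i j => F ∘ₗ singleLinearMap ℂ i j) x = F x := by
  conv_rhs => rw [matrix_eq_sum_single x]
  simp [pair]

/-- Every contractive functional on `M_{k,l}(V)` is of the form `x ↦ ⟨g, a x b⟩` with `g`
completely contractive and `a`, `b` essentially in the Hilbert–Schmidt unit ball. -/
theorem exists_cb_factorization {F : Matrix k l V →ₗ[ℂ] ℂ} (hF : ∀ x, ‖F x‖ ≤ N.nrm x)
    {ε : ℝ} (hε : 0 < ε) :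
    ∃ (g : Matrix k l (Module.Dual ℂ V)) (a : Matrix k k ℂ) (b : Matrix l l ℂ),
      N.CBBound g 1 ∧ hsNorm a * hsNorm b ≤ 1 + ε ∧ ∀ x, F x = pair g (twoSided a x b) := by
  classical
  obtain ⟨a, a', b, b', h1, h2, h3, h4, ha, hb, hbound⟩ := N.exists_density_bound hF hε
  -- Precomposing with the inverse densities absorbs a and b in the density bound; what remains is
  -- exactly the completely contractive estimate for the matrix of `F'`.
  set F' : Matrix k l V →ₗ[ℂ] ℂ :=
    { toFun := fun y => F (twoSided a' y b')
      map_add' := fun y z => by rw [twoSided_add, map_add]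
      map_smul' := fun c y => by rw [twoSided_smul, map_smul]; rfl } with hF'
  have hF'a : ∀ y, F' y = F (twoSided a' y b') := fun _ => rfl
  refine ⟨of fun i j => F' ∘ₗ singleLinearMap ℂ i j, a, b, ?_, ?_, ?_⟩
  · intro p q _ _ α x β
    rw [pair_of_linearMap, hF'a, twoSided_twoSided]
    refine (hbound _ _ _).trans (le_of_eq ?_)
    rw [← Matrix.mul_assoc, h2, Matrix.one_mul, Matrix.mul_assoc, h4, Matrix.mul_one, one_mul]
  · nlinarith [sq_nonneg (hsNorm a - hsNorm b)]
  · intro x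
    rw [pair_of_linearMap, hF'a, twoSided_twoSided, h1, h3, twoSided_one]

theorem exists_norming_functional (x : Matrix k l V) :
    ∃ F : Matrix k l V →ₗ[ℂ] ℂ, (∀ y, ‖F y‖ ≤ N.nrm y) ∧ F x = (N.nrm x : ℂ) := by
  let p : Seminorm ℂ (Matrix k l V) := Seminorm.of N.nrm N.add_le N.nrm_smul
  rcases eq_or_ne x 0 with rfl | hx
  · exact ⟨0, fun y => by simpa using N.nonneg y, by simp [N.nrm_zero]⟩
  let e := LinearEquiv.toSpanNonzeroSingleton ℂ (Matrix k l V) x hx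
  have he : ∀ y, ((e.symm y) • x) = (y : Matrix k l V) := fun y => by simp [e]
  obtain ⟨F, h1, h2⟩ := Module.Dual.exists_extension_of_le_seminorm (Submodule.span ℂ {x})
    ((N.nrm x : ℂ) • (e.symm : _ →ₗ[ℂ] ℂ)) (p := p) fun y => by
      change _ ≤ N.nrm _
      rw [← he y, N.nrm_smul]
      simp [abs_of_nonneg (N.nonneg x), mul_comm]
  refine ⟨F, h2, ?_⟩
  have h3 := h1 (e 1)
  have h4 : ((e 1 : Submodule.span ℂ {x}) : Matrix k l V) = x := by simp [e]
  rw [h4] at h3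
  rw [h3]
  simp

/-- The norm of a matrix over `V` is determined by the completely contractive matrices of
functionals of the same size. -/
theorem nrm_le_of_forall_pair {y : Matrix k l V} {C : ℝ} (hC : 0 ≤ C)
    (h : ∀ g : Matrix k l (Module.Dual ℂ V), N.CBBound g 1 →
      ∀ (α : Matrix k k ℂ) (β : Matrix l l ℂ),
        ‖pair g (twoSided α y β)‖ ≤ C * (hsNorm α * hsNorm β)) : N.nrm y ≤ C := by
  obtain ⟨F, hF, hFy⟩ := N.exists_norming_functional y
  have key : ∀ ε : ℝ, 0 < ε → N.nrm y ≤ C * (1 + ε) := by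
    intro ε hε
    obtain ⟨g, a, b, hg, hab, hfac⟩ := N.exists_cb_factorization hF hε
    have h1 := h g hg a b
    rw [← hfac, hFy, Complex.norm_real, Real.norm_of_nonneg (N.nonneg y)] at h1
    exact h1.trans (mul_le_mul_of_nonneg_left hab hC)
  refine ge_of_tendsto (x := nhdsWithin (0 : ℝ) (Set.Ioi 0)) (f := fun ε => C * (1 + ε)) ?_
    (Filter.eventually_of_mem self_mem_nhdsWithin fun r hr => key r hr)
  have : Filter.Tendsto (fun ε : ℝ => C * (1 + ε)) (nhds 0) (nhds (C * (1 + 0))) :=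
    Continuous.tendsto (by fun_prop) _
  simpa using this.mono_left nhdsWithin_le_nhds

end RuanNorm

/-! ### Ruan's axioms for rectangular matrices over an operator space. -/

section OperatorSpaceNorm

variable {m n k l : Type} [Fintype m] [Fintype n] [Fintype k] [Fintype l]

theorem scalarNorm_submatrix_le (A : Matrix k l ℂ) {e : m → k} {f : n → l}
    (he : Function.Injective e) (hf : Function.Injective f) :
    scalarNorm (A.submatrix e f) ≤ scalarNorm A := by
  classical
  have h : A.submatrix e f = sel e * A * (sel f)ᵀ := by
    ext i j
    simp [mul_apply, sel]
  have h1 := scalarNorm_sel_le he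
  have h2 := scalarNorm_sel_le hf
  rw [← scalarNorm_transpose] at h2
  rw [h]
  calc _ ≤ scalarNorm (sel e) * scalarNorm A * scalarNorm (sel f)ᵀ :=
        (scalarNorm_mul_le _ _).trans
          (mul_le_mul_of_nonneg_right (scalarNorm_mul_le _ _) (scalarNorm_nonneg _))
    _ ≤ 1 * scalarNorm A * 1 := by
        gcongr
        · exact scalarNorm_nonneg _
        · simpa using scalarNorm_nonneg _
        · exact scalarNorm_nonneg _
    _ = _ := by simp

theorem scalarNorm_zero_le {C : ℝ} (hC : 0 ≤ C) : scalarNorm (0 : Matrix m n ℂ) ≤ C :=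
  scalarNorm_le_of_vecNorm hC fun v => by
    have : vecNorm (0 : m → ℂ) = 0 := by simp [vecNorm]
    rw [zero_mulVec, this]
    exact mul_nonneg hC (vecNorm_nonneg v)

variable {X : Type*} [NormedAddCommGroup X] [NormedSpace ℂ X] [OperatorSpace X]

open OperatorSpace (matNorm)

theorem matNorm_nonneg {r : ℕ} (x : Matrix (Fin r) (Fin r) X) : 0 ≤ matNorm x := by
  have h0 : matNorm (0 : Matrix (Fin r) (Fin r) X) = 0 := by
    simpa using OperatorSpace.matNorm_smul (0 : ℂ) (0 : Matrix (Fin r) (Fin r) X)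
  have h1 := OperatorSpace.matNorm_add_le x ((-1 : ℂ) • x)
  rw [OperatorSpace.matNorm_smul, neg_one_smul, add_neg_cancel, h0] at h1
  simp only [norm_neg, norm_one, one_mul] at h1
  linarith

theorem matNorm_submatrix_le {r s : ℕ} (x : Matrix (Fin s) (Fin s) X) {e f : Fin r → Fin s}
    (he : Function.Injective e) (hf : Function.Injective f) :
    matNorm (x.submatrix e f) ≤ matNorm x := by
  rw [← twoSided_sel]
  refine (OperatorSpace.matNorm_twoSided_le _ _ _).trans ?_
  rw [scalarNorm_transpose]
  calc _ ≤ 1 * matNorm x * 1 := by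
        gcongr
        · exact scalarNorm_nonneg _
        · simpa using matNorm_nonneg x
        · exact matNorm_nonneg x
        · exact scalarNorm_sel_le he
        · exact scalarNorm_sel_le hf
    _ = _ := by simp

theorem mnorm_def (x : Matrix m n X) : mnorm x = matNorm
    (Matrix.reindex (Fintype.equivFin (m ⊕ n)) (Fintype.equivFin (m ⊕ n))
      (Matrix.fromBlocks 0 x 0 0)) := rfl

theorem mnorm_twoSided_le (α : Matrix m k ℂ) (x : Matrix k l X) (β : Matrix l n ℂ) :
    mnorm (twoSided α x β) ≤ scalarNorm α * mnorm x * scalarNorm β := by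
  have h : reindex (Fintype.equivFin (m ⊕ n)) (Fintype.equivFin (m ⊕ n))
      (fromBlocks 0 (twoSided α x β) 0 0) =
      twoSided (reindex (Fintype.equivFin (m ⊕ n)) (Fintype.equivFin (k ⊕ l))
          (fromBlocks α 0 0 0))
        (reindex (Fintype.equivFin (k ⊕ l)) (Fintype.equivFin (k ⊕ l)) (fromBlocks 0 x 0 0))
        (reindex (Fintype.equivFin (k ⊕ l)) (Fintype.equivFin (m ⊕ n))
          (fromBlocks 0 0 0 β)) := by
    ext i j
    obtain ⟨i, rfl⟩ := (Fintype.equivFin (m ⊕ n)).surjective i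
    obtain ⟨j, rfl⟩ := (Fintype.equivFin (m ⊕ n)).surjective j
    rw [twoSided_apply, ← (Fintype.equivFin (k ⊕ l)).sum_comp]
    simp only [← (Fintype.equivFin (k ⊕ l)).sum_comp (fun q => (_ : ℂ) • (_ : X))]
    rcases i with i | i <;> rcases j with j | j <;>
      simp [Fintype.sum_sum_type, twoSided_apply]
  rw [mnorm_def, mnorm_def, h]
  refine (OperatorSpace.matNorm_twoSided_le _ _ _).trans ?_
  gcongr
  · exact scalarNorm_nonneg _
  · exact mul_nonneg (scalarNorm_nonneg _) (matNorm_nonneg _)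
  · exact matNorm_nonneg _
  · exact (scalarNorm_submatrix_le _ (Equiv.injective _) (Equiv.injective _)).trans
      (scalarNorm_fromBlocks_le le_rfl (scalarNorm_zero_le (scalarNorm_nonneg _)))
  · exact (scalarNorm_submatrix_le _ (Equiv.injective _) (Equiv.injective _)).trans
      (scalarNorm_fromBlocks_le (scalarNorm_zero_le (scalarNorm_nonneg _)) le_rfl)

theorem mnorm_fromBlocks_le (x : Matrix m n X) (y : Matrix k l X) :
    mnorm (fromBlocks x 0 0 y) ≤ max (mnorm x) (mnorm y) := by
  rw [mnorm_def x, mnorm_def y, ← OperatorSpace.matNorm_directSum, mnorm_def]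
  let g : Fin (Fintype.card ((m ⊕ k) ⊕ (n ⊕ l))) ≃
      Fin (Fintype.card (m ⊕ n) + Fintype.card (k ⊕ l)) :=
    (Fintype.equivFin _).symm.trans ((Equiv.sumSumSumComm m k n l).trans
      ((Equiv.sumCongr (Fintype.equivFin _) (Fintype.equivFin _)).trans finSumFinEquiv))
  refine le_trans (le_of_eq ?_) (matNorm_submatrix_le _ g.injective g.injective)
  congr 1
  ext i j
  obtain ⟨i, rfl⟩ := (Fintype.equivFin ((m ⊕ k) ⊕ (n ⊕ l))).surjective i
  obtain ⟨j, rfl⟩ := (Fintype.equivFin ((m ⊕ k) ⊕ (n ⊕ l))).surjective j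
  rcases i with (i | i) | (i | i) <;> rcases j with (j | j) | (j | j) <;> simp [g]

/-- The rectangular matrix norms of an operator space. -/
def opRuan (X : Type*) [NormedAddCommGroup X] [NormedSpace ℂ X] [OperatorSpace X] :
    RuanNorm X where
  nrm x := mnorm x
  nonneg x := matNorm_nonneg _
  add_le x y := by
    simp only [mnorm_def]
    refine le_trans (le_of_eq ?_) (OperatorSpace.matNorm_add_le _ _)
    congr 1
    ext i j
    obtain ⟨i, rfl⟩ := (Fintype.equivFin _).surjective i
    obtain ⟨j, rfl⟩ := (Fintype.equivFin _).surjective j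
    rcases i with i | i <;> rcases j with j | j <;> simp
  smul_le c x := by
    simp only [mnorm_def]
    refine le_of_eq ?_
    rw [← OperatorSpace.matNorm_smul]
    congr 1
    ext i j
    obtain ⟨i, rfl⟩ := (Fintype.equivFin _).surjective i
    obtain ⟨j, rfl⟩ := (Fintype.equivFin _).surjective j
    rcases i with i | i <;> rcases j with j | j <;> simp
  twoSided_le := mnorm_twoSided_le
  fromBlocks_le := mnorm_fromBlocks_le

theorem mnorm_eq_opRuan (x : Matrix m n X) : mnorm x = (opRuan X).nrm x := rfl

/-- The rectangular norm views x as a corner of a 2 × 2 matrix; multiplication by a unit column and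
a unit row, and passage to a submatrix, compare this with M_1(X). -/
theorem opRuan_singleton (x : X) : (opRuan X).nrm (of fun _ _ : Fin 1 => x) = ‖x‖ := by
  rw [← mnorm_eq_opRuan, ← OperatorSpace.matNorm_one, mnorm_def]
  refine le_antisymm ?_ ?_
  · have h : reindex (Fintype.equivFin (Fin 1 ⊕ Fin 1)) (Fintype.equivFin (Fin 1 ⊕ Fin 1))
        (fromBlocks 0 (of fun _ _ : Fin 1 => x) 0 0) =
        twoSided (reindex (Fintype.equivFin (Fin 1 ⊕ Fin 1)) (Equiv.refl (Fin 1))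
            (fromRows 1 0)) (of fun _ _ : Fin 1 => x)
          (reindex (Equiv.refl (Fin 1)) (Fintype.equivFin (Fin 1 ⊕ Fin 1)) (fromCols 0 1)) := by
      ext i j
      obtain ⟨i, rfl⟩ := (Fintype.equivFin (Fin 1 ⊕ Fin 1)).surjective i
      obtain ⟨j, rfl⟩ := (Fintype.equivFin (Fin 1 ⊕ Fin 1)).surjective j
      rcases i with i | i <;> rcases j with j | j <;> fin_cases i <;> fin_cases j <;>
        simp [twoSided_apply]
    rw [h]
    refine (OperatorSpace.matNorm_twoSided_le _ _ _).trans ?_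
    have h1 : scalarNorm (fromRows (1 : Matrix (Fin 1) (Fin 1) ℂ)
        (0 : Matrix (Fin 1) (Fin 1) ℂ)) ≤ 1 := by
      refine le_of_sq_le_sq ((scalarNorm_fromRows_sq_le _ _).trans ?_) zero_le_one
      nlinarith [scalarNorm_one_le (n := Fin 1), scalarNorm_nonneg (1 : Matrix (Fin 1) (Fin 1) ℂ),
        scalarNorm_zero_le (m := Fin 1) (n := Fin 1) le_rfl,
        scalarNorm_nonneg (0 : Matrix (Fin 1) (Fin 1) ℂ)]
    have h2 : scalarNorm (fromCols (0 : Matrix (Fin 1) (Fin 1) ℂ)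
        (1 : Matrix (Fin 1) (Fin 1) ℂ)) ≤ 1 := by
      refine le_of_sq_le_sq ((scalarNorm_fromCols_sq_le _ _).trans ?_) zero_le_one
      nlinarith [scalarNorm_one_le (n := Fin 1), scalarNorm_nonneg (1 : Matrix (Fin 1) (Fin 1) ℂ),
        scalarNorm_zero_le (m := Fin 1) (n := Fin 1) le_rfl,
        scalarNorm_nonneg (0 : Matrix (Fin 1) (Fin 1) ℂ)]
    have h3 := (scalarNorm_submatrix_le _ (Fintype.equivFin (Fin 1 ⊕ Fin 1)).symm.injective
      (Equiv.refl (Fin 1)).symm.injective).trans h1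
    have h4 := (scalarNorm_submatrix_le _ (Equiv.refl (Fin 1)).symm.injective
      (Fintype.equivFin (Fin 1 ⊕ Fin 1)).symm.injective).trans h2
    have h5 := matNorm_nonneg (of fun _ _ : Fin 1 => x)
    calc _ ≤ 1 * matNorm (of fun _ _ : Fin 1 => x) * 1 := by
          refine mul_le_mul (mul_le_mul_of_nonneg_right h3 h5) h4 (scalarNorm_nonneg _) ?_
          simpa using h5
      _ = _ := by simp
  · refine le_trans (le_of_eq ?_) (matNorm_submatrix_le _
      ((Fintype.equivFin (Fin 1 ⊕ Fin 1)).injective.comp Sum.inl_injective)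
      ((Fintype.equivFin (Fin 1 ⊕ Fin 1)).injective.comp Sum.inr_injective))
    congr 1
    ext i j
    simp

end OperatorSpaceNorm

/-! ### The dual matrix norms through the trace pairing. -/

section DualNorm

variable {m n k l : Type} [Fintype m] [Fintype n] [Fintype k] [Fintype l]
variable {X : Type*} [NormedAddCommGroup X] [NormedSpace ℂ X] [OperatorSpace X]

/-- The underlying matrix of algebraic functionals. -/
def toAlg (f : Matrix m n (StrongDual ℂ X)) : Matrix m n (Module.Dual ℂ X) :=
  f.map fun φ => φ.toLinearMap

/-- Test the matrix [f_ij(x_pq)] on vectors u and v: reshaped as matrices α and β they give ⟨f,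
αxβ⟩, and their Euclidean norms are ‖α‖₂ and ‖β‖₂. Rectangular x are reduced to square ones by
padding with zeros. -/
theorem cbBound_toAlg_iff {f : Matrix m n (StrongDual ℂ X)} {C : ℝ} (hC : 0 ≤ C) :
    (∀ (r : ℕ) (x : Matrix (Fin r) (Fin r) X),
      scalarNorm (of fun (a : Fin r × m) (b : Fin r × n) => f a.2 b.2 (x a.1 b.1)) ≤
        C * mnorm x) ↔ (opRuan X).CBBound (toAlg f) C := by
  have hbil : ∀ {k l : Type} [Fintype k] [Fintype l] (α : Matrix m k ℂ) (x : Matrix k l X)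
      (β : Matrix l n ℂ), pair (toAlg f) (twoSided α x β) =
      ∑ a : k × m, ∑ b : l × n, α a.2 a.1 * f a.2 b.2 (x a.1 b.1) * β b.1 b.2 := by
    intro k l _ _ α x β
    simp only [pair, toAlg, twoSided_apply, map_apply, map_sum, map_smul, smul_eq_mul,
      Fintype.sum_prod_type, ContinuousLinearMap.coe_coe]
    calc _ = ∑ i, ∑ p, ∑ j, ∑ q, α i p * β q j * f i j (x p q) :=
          Finset.sum_congr rfl fun i _ => Finset.sum_comm
      _ = ∑ p, ∑ i, ∑ q, ∑ j, α i p * β q j * f i j (x p q) := by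
          rw [Finset.sum_comm]
          exact Finset.sum_congr rfl fun p' _ => Finset.sum_congr rfl fun p _ => Finset.sum_comm
      _ = _ := Finset.sum_congr rfl fun p _ => Finset.sum_congr rfl fun i _ =>
          Finset.sum_congr rfl fun q _ => Finset.sum_congr rfl fun j _ => by ring
  have hhs : ∀ {k : Type} [Fintype k] (α : Matrix m k ℂ),
      vecNorm (fun a : k × m => α a.2 a.1) = hsNorm α := by
    intro k _ α
    rw [← hsNorm_transpose, hsNorm_eq_vecNorm]
    rfl
  constructor
  · intro h k l _ _ α x β
    set e := Fintype.equivFin (k ⊕ l)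
    set x' := reindex e e (fromBlocks 0 x 0 0) with hx'
    have h1 : scalarNorm (of fun (a : k × m) (b : l × n) => f a.2 b.2 (x a.1 b.1)) ≤
        C * mnorm x := by
      refine le_trans ?_ ((h _ x').trans ?_)
      · have he : Function.Injective (Prod.map (e ∘ Sum.inl) id : k × m → _ × m) :=
          (e.injective.comp Sum.inl_injective).prodMap Function.injective_id
        have hf : Function.Injective (Prod.map (e ∘ Sum.inr) id : l × n → _ × n) :=
          (e.injective.comp Sum.inr_injective).prodMap Function.injective_id
        refine le_trans (le_of_eq ?_) (scalarNorm_submatrix_le _ he hf)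
        congr 1
        ext a b
        simp [hx']
      · refine mul_le_mul_of_nonneg_left ?_ hC
        exact ((opRuan X).nrm_submatrix_equiv _ e.symm e.symm).trans_le
          ((opRuan X).nrm_fromBlocks_corner_le x)
    rw [hbil]
    refine (norm_bilin_le (of fun (a : k × m) (b : l × n) => f a.2 b.2 (x a.1 b.1))
      (fun a => α a.2 a.1) (fun b => β b.1 b.2)).trans ?_
    rw [hhs, ← hsNorm_eq_vecNorm]
    have := mul_le_mul_of_nonneg_right h1 (mul_nonneg (hsNorm_nonneg α) (hsNorm_nonneg β))
    rw [mnorm_eq_opRuan] at this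
    linarith
  · intro h r x
    refine scalarNorm_le_of_bilin (mul_nonneg hC ((opRuan X).nonneg x)) fun u v => ?_
    have h1 := h (of fun i a => u (a, i)) x (of fun b j => v (b, j))
    rw [hbil, ← hhs, hsNorm_eq_vecNorm] at h1
    simp only [of_apply] at h1 ⊢
    rw [mnorm_eq_opRuan]
    linarith

/-- This crude bound ensures that the infimum defining the dual norm is over a nonempty set. -/
theorem exists_cbBound (f : Matrix m n (StrongDual ℂ X)) :
    (opRuan X).CBBound (toAlg f) (∑ i, ∑ j, ‖f i j‖) := by
  intro k l _ _ α x β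
  have hentry : ∀ i j, ‖twoSided α x β i j‖ ≤ hsNorm α * (opRuan X).nrm x * hsNorm β := by
    intro i j
    have h1 : (of fun _ _ : Fin 1 => twoSided α x β i j) =
        (twoSided α x β).submatrix (fun _ : Fin 1 => i) (fun _ : Fin 1 => j) := rfl
    rw [← opRuan_singleton, h1]
    refine ((opRuan X).nrm_submatrix_le _ (Function.injective_of_subsingleton _)
      (Function.injective_of_subsingleton _)).trans (((opRuan X).twoSided_le α x β).trans ?_)
    have := (opRuan X).nonneg x
    gcongr
    · exact scalarNorm_nonneg _
    · exact mul_nonneg (hsNorm_nonneg _) this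
    · exact scalarNorm_le_hsNorm α
    · exact scalarNorm_le_hsNorm β
  rw [pair, Finset.sum_mul]
  refine (norm_sum_le _ _).trans (Finset.sum_le_sum fun i _ => ?_)
  rw [Finset.sum_mul]
  refine (norm_sum_le _ _).trans (Finset.sum_le_sum fun j _ => ?_)
  exact ((f i j).le_opNorm _).trans (mul_le_mul_of_nonneg_left (hentry i j) (norm_nonneg _))

theorem dual_mnorm_def (f : Matrix m n (StrongDual ℂ X)) :
    mnorm f = sInf {C : ℝ | 0 ≤ C ∧ (opRuan X).CBBound (toAlg f) C} := by
  change sInf _ = _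
  congr 1
  ext C
  exact and_congr_right fun hC => cbBound_toAlg_iff hC

theorem dual_mnorm_nonneg (f : Matrix m n (StrongDual ℂ X)) : 0 ≤ mnorm f := by
  rw [dual_mnorm_def]
  exact Real.sInf_nonneg fun C hC => hC.1

theorem dual_mnorm_le {f : Matrix m n (StrongDual ℂ X)} {C : ℝ} (hC : 0 ≤ C)
    (h : (opRuan X).CBBound (toAlg f) C) : mnorm f ≤ C := by
  rw [dual_mnorm_def]
  exact csInf_le ⟨0, fun C hC => hC.1⟩ ⟨hC, h⟩

theorem cbBound_mnorm (f : Matrix m n (StrongDual ℂ X)) :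
    (opRuan X).CBBound (toAlg f) (mnorm f) := by
  intro k l _ _ α x β
  have hne : {C : ℝ | 0 ≤ C ∧ (opRuan X).CBBound (toAlg f) C}.Nonempty :=
    ⟨_, Finset.sum_nonneg fun i _ => Finset.sum_nonneg fun j _ => norm_nonneg _, exists_cbBound f⟩
  set t := hsNorm α * (opRuan X).nrm x * hsNorm β with ht
  have ht0 : 0 ≤ t := mul_nonneg (mul_nonneg (hsNorm_nonneg _) ((opRuan X).nonneg x))
    (hsNorm_nonneg _)
  rcases ht0.eq_or_lt with h0 | h0
  · obtain ⟨C, -, hC⟩ := hne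
    have := hC α x β
    rw [← ht, ← h0, mul_zero] at this
    rwa [← h0, mul_zero]
  · rw [← div_le_iff₀ h0, dual_mnorm_def]
    refine le_csInf hne fun C hC => ?_
    rw [div_le_iff₀ h0]
    exact hC.2 α x β

theorem CBBound_mono {f : Matrix m n (Module.Dual ℂ X)} {C D : ℝ}
    (h : (opRuan X).CBBound f C) (hCD : C ≤ D) : (opRuan X).CBBound f D := by
  intro k l _ _ α x β
  exact (h α x β).trans (mul_le_mul_of_nonneg_right hCD
    (mul_nonneg (mul_nonneg (hsNorm_nonneg _) ((opRuan X).nonneg x)) (hsNorm_nonneg _)))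

/-- Testing with unit coordinate columns and rows isolates an entry and bounds it by `C`, so
algebraic functionals produced by Hahn–Banach are automatically continuous. -/
theorem exists_toAlg_eq {g : Matrix m n (Module.Dual ℂ X)} {C : ℝ}
    (h : (opRuan X).CBBound g C) : ∃ f : Matrix m n (StrongDual ℂ X), toAlg f = g := by
  classical
  have hb : ∀ i j x, ‖g i j x‖ ≤ C * ‖x‖ := by
    intro i j x
    have h1 := h (of fun p (_ : Fin 1) => if p = i then 1 else 0) (of fun _ _ : Fin 1 => x)
      (of fun (_ : Fin 1) q => if q = j then 1 else 0)
    have h2 : hsNorm (of fun p (_ : Fin 1) => if p = i then (1 : ℂ) else 0) = 1 := by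
      simp [hsNorm, apply_ite]
    have h3 : hsNorm (of fun (_ : Fin 1) q => if q = j then (1 : ℂ) else 0) = 1 := by
      simp [hsNorm, apply_ite]
    rw [h2, h3, opRuan_singleton, one_mul, mul_one] at h1
    convert h1 using 2
    rw [pair, Finset.sum_eq_single i (by simp +contextual [twoSided_apply]) (by simp),
      Finset.sum_eq_single j (by simp +contextual [twoSided_apply]) (by simp)]
    simp [twoSided_apply]
  refine ⟨of fun i j => (g i j).mkContinuous C (hb i j), ?_⟩
  ext i j x
  simp [toAlg]

theorem toAlg_twoSided {m n k l : Type} [Fintype k] [Fintype l] {X : Type*}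
    [NormedAddCommGroup X] [NormedSpace ℂ X] (α : Matrix m k ℂ) (f : Matrix k l (StrongDual ℂ X))
    (β : Matrix l n ℂ) : toAlg (twoSided α f β) = twoSided α (toAlg f) β := by
  ext i j x
  simp [toAlg, twoSided_apply]

/-- The matrix norms of the dual of an operator space. -/
def dualRuan (X : Type*) [NormedAddCommGroup X] [NormedSpace ℂ X] [OperatorSpace X] :
    RuanNorm (StrongDual ℂ X) where
  nrm f := mnorm f
  nonneg := dual_mnorm_nonneg
  add_le f g := by
    refine dual_mnorm_le (add_nonneg (dual_mnorm_nonneg f) (dual_mnorm_nonneg g)) ?_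
    intro k l _ _ α x β
    have h : toAlg (f + g) = toAlg f + toAlg g := rfl
    rw [h, add_pair, add_mul]
    exact (norm_add_le _ _).trans (add_le_add (cbBound_mnorm f α x β) (cbBound_mnorm g α x β))
  smul_le c f := by
    refine dual_mnorm_le (mul_nonneg (norm_nonneg c) (dual_mnorm_nonneg f)) ?_
    intro k l _ _ α x β
    have h : toAlg (c • f) = c • toAlg f := rfl
    rw [h, smul_pair, norm_mul, mul_assoc]
    exact mul_le_mul_of_nonneg_left (cbBound_mnorm f α x β) (norm_nonneg c)
  twoSided_le γ f δ := by
    refine dual_mnorm_le (mul_nonneg (mul_nonneg (scalarNorm_nonneg _) (dual_mnorm_nonneg f))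
      (scalarNorm_nonneg _)) ?_
    intro k l _ _ α x β
    have h : pair (toAlg (twoSided γ f δ)) (twoSided α x β) =
        pair (toAlg f) (twoSided (γᵀ * α) x (β * δᵀ)) := by
      rw [toAlg_twoSided, ← twoSided_twoSided, pair_twoSided (toAlg f)]
      simp
    rw [h]
    refine (cbBound_mnorm f _ _ _).trans ?_
    have h1 := hsNorm_mul_le γᵀ α
    have h2 := hsNorm_mul_le' β δᵀ
    rw [scalarNorm_transpose] at h1 h2
    have h3 := dual_mnorm_nonneg f
    have h4 := (opRuan X).nonneg x
    have h5 : hsNorm (γᵀ * α) * (opRuan X).nrm x * hsNorm (β * δᵀ) ≤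
        (scalarNorm γ * hsNorm α) * (opRuan X).nrm x * (hsNorm β * scalarNorm δ) := by
      refine mul_le_mul (mul_le_mul_of_nonneg_right h1 h4) h2 (hsNorm_nonneg _) ?_
      exact mul_nonneg (mul_nonneg (scalarNorm_nonneg _) (hsNorm_nonneg _)) h4
    refine (mul_le_mul_of_nonneg_left h5 h3).trans (le_of_eq ?_)
    ring
  fromBlocks_le f g := by
    refine dual_mnorm_le ((dual_mnorm_nonneg f).trans (le_max_left _ _)) ?_
    intro k l _ _ α x β
    have h : toAlg (fromBlocks f 0 0 g) = fromBlocks (toAlg f) 0 0 (toAlg g) := by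
      ext (i | i) (j | j) <;> rfl
    have hα : α = fromRows α.toRows₁ α.toRows₂ := (fromRows_toRows α).symm
    have hβ : β = fromCols β.toCols₁ β.toCols₂ := (fromCols_toCols β).symm
    have e1 : (twoSided α x β).toBlocks₁₁ = twoSided α.toRows₁ x β.toCols₁ := rfl
    have e2 : (twoSided α x β).toBlocks₂₂ = twoSided α.toRows₂ x β.toCols₂ := rfl
    rw [h, pair_fromBlocks, e1, e2]
    have h1 := CBBound_mono (cbBound_mnorm f) (le_max_left _ (mnorm g)) α.toRows₁ x β.toCols₁
    have h2 := CBBound_mono (cbBound_mnorm g) (le_max_right (mnorm f) _) α.toRows₂ x β.toCols₂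
    refine (norm_add_le _ _).trans ((add_le_add h1 h2).trans ?_)
    rw [← mul_add]
    refine mul_le_mul_of_nonneg_left ?_ ((dual_mnorm_nonneg f).trans (le_max_left _ _))
    have hα2 := hsNorm_fromRows_sq α.toRows₁ α.toRows₂
    have hβ2 := hsNorm_fromCols_sq β.toCols₁ β.toCols₂
    rw [← hα] at hα2
    rw [← hβ] at hβ2
    -- Cauchy–Schwarz in ℝ²: the squared Hilbert–Schmidt norms of the two pieces add up to those of
    -- α and β.
    have h5 : hsNorm α.toRows₁ * hsNorm β.toCols₁ + hsNorm α.toRows₂ * hsNorm β.toCols₂ ≤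
        hsNorm α * hsNorm β := by
      refine le_of_sq_le_sq ?_ (mul_nonneg (hsNorm_nonneg _) (hsNorm_nonneg _))
      rw [mul_pow, hα2, hβ2]
      nlinarith [sq_nonneg (hsNorm α.toRows₁ * hsNorm β.toCols₂ -
        hsNorm α.toRows₂ * hsNorm β.toCols₁)]
    nlinarith [mul_le_mul_of_nonneg_left h5 ((opRuan X).nonneg x)]

theorem mnorm_eq_dualRuan (f : Matrix m n (StrongDual ℂ X)) : mnorm f = (dualRuan X).nrm f := rfl

theorem dualRuan_le_iff {f : Matrix m n (StrongDual ℂ X)} {C : ℝ} (hC : 0 ≤ C) :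
    (dualRuan X).nrm f ≤ C ↔ (opRuan X).CBBound (toAlg f) C :=
  ⟨fun h => CBBound_mono (cbBound_mnorm f) h, dual_mnorm_le hC⟩

end DualNorm

/-! ### The projective tensor product R_2[V] by one-sided factorizations. -/

section RowNorm

variable {V : Type*} [AddCommGroup V] [Module ℂ V] (N : RuanNorm V)
variable {m n k l : Type} [Fintype m] [Fintype n] [Fintype k] [Fintype l]

/-- The products `‖[a₁ a₂]‖ ‖w‖ ‖b‖` over all factorizations `xₛ = aₛ w b` of a pair of matrices. -/
def rowSet (x : Matrix m n (V × V)) : Set ℝ :=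
  {r | ∃ (k l : Type) (_ : Fintype k) (_ : Fintype l) (a₁ a₂ : Matrix m k ℂ) (w : Matrix k l V)
    (b : Matrix l n ℂ), x.map Prod.fst = twoSided a₁ w b ∧ x.map Prod.snd = twoSided a₂ w b ∧
      r = scalarNorm (fromCols a₁ a₂) * N.nrm w * scalarNorm b}

/-- The norm of `[x₁ x₂]` in the matrix spaces over `R_2[V]`. -/
def rowNrm (x : Matrix m n (V × V)) : ℝ := sInf (rowSet N x)

variable {N}

theorem nonneg_of_mem_rowSet {x : Matrix m n (V × V)} {r : ℝ} (h : r ∈ rowSet N x) : 0 ≤ r := by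
  obtain ⟨k, l, _, _, a₁, a₂, w, b, -, -, rfl⟩ := h
  exact mul_nonneg (mul_nonneg (scalarNorm_nonneg _) (N.nonneg w)) (scalarNorm_nonneg _)

theorem rowNrm_le {x : Matrix m n (V × V)} {a₁ a₂ : Matrix m k ℂ} {w : Matrix k l V}
    {b : Matrix l n ℂ} (h₁ : x.map Prod.fst = twoSided a₁ w b)
    (h₂ : x.map Prod.snd = twoSided a₂ w b) {A W B : ℝ} (hA : scalarNorm (fromCols a₁ a₂) ≤ A)
    (hW : N.nrm w ≤ W) (hB : scalarNorm b ≤ B) : rowNrm N x ≤ A * W * B := by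
  refine (csInf_le ⟨0, fun r hr => nonneg_of_mem_rowSet hr⟩
    ⟨k, l, _, _, a₁, a₂, w, b, h₁, h₂, rfl⟩).trans ?_
  have h3 := (scalarNorm_nonneg _).trans hA
  have h4 := (N.nonneg w).trans hW
  exact mul_le_mul (mul_le_mul hA hW (N.nonneg w) h3) hB (scalarNorm_nonneg _) (mul_nonneg h3 h4)

theorem twoSided_one_right_fromRows [DecidableEq m] [DecidableEq n] (x y : Matrix m n V) :
    twoSided (fromCols (1 : Matrix m m ℂ) 0) (fromRows x y) 1 = x ∧
      twoSided (fromCols 0 (1 : Matrix m m ℂ)) (fromRows x y) 1 = y := by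
  have h : ∀ z : Matrix m n V, twoSided (0 : Matrix m m ℂ) z (1 : Matrix n n ℂ) = 0 := fun z => by
    ext i j; simp [twoSided_apply]
  rw [twoSided_fromRows, twoSided_fromRows, twoSided_one, twoSided_one, h, h, add_zero, zero_add]
  exact ⟨rfl, rfl⟩

theorem rowSet_nonempty (x : Matrix m n (V × V)) : (rowSet N x).Nonempty := by
  classical
  obtain ⟨h1, h2⟩ := twoSided_one_right_fromRows (x.map Prod.fst) (x.map Prod.snd)
  exact ⟨_, m ⊕ m, n, inferInstance, inferInstance, _, _, _, _, h1.symm, h2.symm, rfl⟩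

theorem rowNrm_nonneg (x : Matrix m n (V × V)) : 0 ≤ rowNrm N x :=
  Real.sInf_nonneg fun _ hr => nonneg_of_mem_rowSet hr

theorem fromCols_smul {m k l : Type} (c : ℂ) (a₁ : Matrix m k ℂ) (a₂ : Matrix m l ℂ) :
    fromCols (c • a₁) (c • a₂) = c • fromCols a₁ a₂ := by
  ext i (j | j) <;> simp

/-- Normal form of a near-optimal factorization: w in the unit ball and the rest shared equally
between the two scalar sides, so that blocks can be combined. -/
theorem exists_of_rowNrm_lt {x : Matrix m n (V × V)} {C : ℝ} (h : rowNrm N x < C) :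
    ∃ (k l : Type) (_ : Fintype k) (_ : Fintype l) (a₁ a₂ : Matrix m k ℂ) (w : Matrix k l V)
      (b : Matrix l n ℂ), x.map Prod.fst = twoSided a₁ w b ∧ x.map Prod.snd = twoSided a₂ w b ∧
      scalarNorm (fromCols a₁ a₂) ≤ √C ∧ N.nrm w ≤ 1 ∧ scalarNorm b ≤ √C := by
  have hC : 0 < C := (rowNrm_nonneg x).trans_lt h
  obtain ⟨_, ⟨k, l, _, _, a₁, a₂, w, b, h₁, h₂, rfl⟩, hlt⟩ := exists_lt_of_csInf_lt
    (rowSet_nonempty x) h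
  set A := scalarNorm (fromCols a₁ a₂) with hA
  set B := scalarNorm b with hB
  set W := N.nrm w with hW
  have hA0 : 0 ≤ A := scalarNorm_nonneg _
  have hB0 : 0 ≤ B := scalarNorm_nonneg _
  have hW0 : 0 ≤ W := N.nonneg w
  -- Enlarging the three norms slightly allows division even if some of them vanish.
  obtain ⟨δ, hδ, hδ0⟩ : ∃ δ : ℝ, (A + δ) * (W + δ) * (B + δ) < C ∧ 0 < δ := by
    have hcont : Filter.Tendsto (fun δ : ℝ => (A + δ) * (W + δ) * (B + δ)) (nhds 0)
        (nhds ((A + 0) * (W + 0) * (B + 0))) := Continuous.tendsto (by fun_prop) _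
    simp only [add_zero] at hcont
    have h1 := (hcont.mono_left (nhdsWithin_le_nhds (s := Set.Ioi 0))).eventually_lt_const hlt
    exact (h1.and self_mem_nhdsWithin).exists
  set A' := A + δ
  set B' := B + δ
  set W' := W + δ
  have hA' : 0 < A' := by positivity
  have hB' : 0 < B' := by positivity
  have hW' : 0 < W' := by positivity
  have hsC : 0 < √C := Real.sqrt_pos.2 hC
  have hcoef : ((√C / A' : ℝ) : ℂ) * ((A' * W' / √C : ℝ) : ℂ) * ((W'⁻¹ : ℝ) : ℂ) = 1 := by
    rw [← Complex.ofReal_mul, ← Complex.ofReal_mul, ← Complex.ofReal_one]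
    congr 1
    field_simp
  have hfac : ∀ a : Matrix m k ℂ, twoSided (((√C / A' : ℝ) : ℂ) • a) (((W'⁻¹ : ℝ) : ℂ) • w)
      (((A' * W' / √C : ℝ) : ℂ) • b) = twoSided a w b := fun a => by
    rw [smul_twoSided, twoSided_smul_right, twoSided_smul, smul_smul, smul_smul, hcoef, one_smul]
  refine ⟨k, l, inferInstance, inferInstance, ((√C / A' : ℝ) : ℂ) • a₁, ((√C / A' : ℝ) : ℂ) • a₂,
    ((W'⁻¹ : ℝ) : ℂ) • w, ((A' * W' / √C : ℝ) : ℂ) • b, by rw [hfac, h₁], by rw [hfac, h₂],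
    ?_, ?_, ?_⟩
  · rw [fromCols_smul]
    refine (scalarNorm_smul_le _ _).trans ?_
    rw [Complex.norm_real, Real.norm_of_nonneg (by positivity), ← hA, div_mul_eq_mul_div,
      div_le_iff₀ hA']
    exact mul_le_mul_of_nonneg_left (by simp only [A']; linarith) hsC.le
  · rw [N.nrm_smul, Complex.norm_real, Real.norm_of_nonneg (by positivity), inv_mul_le_iff₀ hW']
    simp only [W']; linarith
  · refine (scalarNorm_smul_le _ _).trans ?_
    rw [Complex.norm_real, Real.norm_of_nonneg (by positivity), ← hB, div_mul_eq_mul_div,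
      div_le_iff₀ hsC, Real.mul_self_sqrt hC.le]
    refine le_trans ?_ hδ.le
    exact mul_le_mul_of_nonneg_left (by simp only [B']; linarith) (by positivity)

theorem rowNrm_add_le (x y : Matrix m n (V × V)) :
    rowNrm N (x + y) ≤ rowNrm N x + rowNrm N y := by
  have key : ∀ {C D : ℝ}, rowNrm N x < C → rowNrm N y < D → rowNrm N (x + y) ≤ C + D := by
    intro C D hC hD
    obtain ⟨k, l, _, _, a₁, a₂, w, b, h₁, h₂, ha, hw, hb⟩ := exists_of_rowNrm_lt hC
    obtain ⟨k', l', _, _, a₁', a₂', w', b', h₁', h₂', ha', hw', hb'⟩ := exists_of_rowNrm_lt hD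
    have hC0 : 0 ≤ C := (rowNrm_nonneg x).trans hC.le
    have hD0 : 0 ≤ D := (rowNrm_nonneg y).trans hD.le
    have hsq : ∀ {s t u : ℝ}, 0 ≤ s → 0 ≤ t → s ≤ √C → t ≤ √D → u ^ 2 ≤ s ^ 2 + t ^ 2 →
        u ≤ √(C + D) := by
      intro s t u hs ht h1 h2 h3
      refine Real.le_sqrt_of_sq_le (h3.trans (add_le_add ?_ ?_))
      · calc s ^ 2 ≤ √C ^ 2 := pow_le_pow_left₀ hs h1 2
          _ = C := Real.sq_sqrt hC0
      · calc t ^ 2 ≤ √D ^ 2 := pow_le_pow_left₀ ht h2 2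
          _ = D := Real.sq_sqrt hD0
    have hmain := rowNrm_le (N := N) (x := x + y) (a₁ := fromCols a₁ a₁') (a₂ := fromCols a₂ a₂')
      -- The equal sharing pays off here: the scalar sides have norm at most √(C + D) each, and the
      -- direct sum of w and w' stays in the unit ball.
      (w := fromBlocks w 0 0 w') (b := fromRows b b') (A := √(C + D)) (W := 1) (B := √(C + D))
      ?_ ?_ ?_ ((N.fromBlocks_le w w').trans (max_le hw hw')) ?_
    · rwa [mul_one, Real.mul_self_sqrt (add_nonneg hC0 hD0)] at hmain
    · rw [twoSided_fromBlocks, ← h₁, ← h₁']; rfl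
    · rw [twoSided_fromBlocks, ← h₂, ← h₂']; rfl
    · have : fromCols (fromCols a₁ a₁') (fromCols a₂ a₂') =
          (fromCols (fromCols a₁ a₂) (fromCols a₁' a₂')).submatrix id
            (Equiv.sumSumSumComm k k' k k') := by
        ext i ((j | j) | (j | j)) <;> rfl
      rw [this]
      exact (scalarNorm_submatrix_le _ Function.injective_id (Equiv.injective _)).trans
        (hsq (scalarNorm_nonneg _) (scalarNorm_nonneg _) ha ha' (scalarNorm_fromCols_sq_le _ _))
    · exact hsq (scalarNorm_nonneg _) (scalarNorm_nonneg _) hb hb' (scalarNorm_fromRows_sq_le _ _)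
  refine le_of_forall_pos_le_add fun ε hε => ?_
  have := key (lt_add_of_pos_right (rowNrm N x) (half_pos hε))
    (lt_add_of_pos_right (rowNrm N y) (half_pos hε))
  linarith

theorem rowNrm_fromBlocks_le (x : Matrix m n (V × V)) (y : Matrix k l (V × V)) :
    rowNrm N (fromBlocks x 0 0 y) ≤ max (rowNrm N x) (rowNrm N y) := by
  have key : ∀ {C : ℝ}, max (rowNrm N x) (rowNrm N y) < C →
      rowNrm N (fromBlocks x 0 0 y) ≤ C := by
    intro C hC
    have hC0 : 0 ≤ C := (rowNrm_nonneg x).trans ((le_max_left _ _).trans hC.le)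
    obtain ⟨k, l, _, _, a₁, a₂, w, b, h₁, h₂, ha, hw, hb⟩ :=
      exists_of_rowNrm_lt ((le_max_left _ _).trans_lt hC)
    obtain ⟨k', l', _, _, a₁', a₂', w', b', h₁', h₂', ha', hw', hb'⟩ :=
      exists_of_rowNrm_lt ((le_max_right _ _).trans_lt hC)
    have hmain := rowNrm_le (N := N) (x := fromBlocks x 0 0 y) (a₁ := fromBlocks a₁ 0 0 a₁')
      (a₂ := fromBlocks a₂ 0 0 a₂') (w := fromBlocks w 0 0 w') (b := fromBlocks b 0 0 b')
      (A := √C) (W := 1) (B := √C)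
      ?_ ?_ ?_ ((N.fromBlocks_le w w').trans (max_le hw hw')) (scalarNorm_fromBlocks_le hb hb')
    · rwa [mul_one, Real.mul_self_sqrt hC0] at hmain
    · rw [twoSided_fromBlocks_fromBlocks, ← h₁, ← h₁', fromBlocks_map]; rfl
    · rw [twoSided_fromBlocks_fromBlocks, ← h₂, ← h₂', fromBlocks_map]; rfl
    · have : fromCols (fromBlocks a₁ 0 0 a₁') (fromBlocks a₂ 0 0 a₂') =
          (fromBlocks (fromCols a₁ a₂) 0 0 (fromCols a₁' a₂')).submatrix id
            (Equiv.sumSumSumComm k k' k k') := by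
        ext (i | i) ((j | j) | (j | j)) <;> rfl
      rw [this]
      exact (scalarNorm_submatrix_le _ Function.injective_id (Equiv.injective _)).trans
        (scalarNorm_fromBlocks_le ha ha')
  exact le_of_forall_pos_le_add fun ε hε => key (lt_add_of_pos_right _ hε)

theorem rowNrm_twoSided_le (α : Matrix m k ℂ) (x : Matrix k l (V × V)) (β : Matrix l n ℂ) :
    rowNrm N (twoSided α x β) ≤ scalarNorm α * rowNrm N x * scalarNorm β := by
  have key : ∀ ε : ℝ, 0 < ε →
      rowNrm N (twoSided α x β) ≤ scalarNorm α * (rowNrm N x + ε) * scalarNorm β := by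
    intro ε hε
    have hC0 : 0 ≤ rowNrm N x + ε := by linarith [rowNrm_nonneg (N := N) x]
    obtain ⟨k, l, _, _, a₁, a₂, w, b, h₁, h₂, ha, hw, hb⟩ :=
      exists_of_rowNrm_lt (lt_add_of_pos_right (rowNrm N x) hε)
    have e1 : (twoSided α x β).map Prod.fst = twoSided (α * a₁) w (b * β) := by
      rw [← twoSided_twoSided, ← h₁]
      exact twoSided_map (LinearMap.fst ℂ V V) α x β
    have e2 : (twoSided α x β).map Prod.snd = twoSided (α * a₂) w (b * β) := by
      rw [← twoSided_twoSided, ← h₂]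
      exact twoSided_map (LinearMap.snd ℂ V V) α x β
    refine (rowNrm_le e1 e2 (A := scalarNorm α * √(rowNrm N x + ε)) ?_ hw
      ((scalarNorm_mul_le b β).trans (mul_le_mul_of_nonneg_right hb
        (scalarNorm_nonneg β)))).trans ?_
    · rw [← mul_fromCols]
      exact (scalarNorm_mul_le _ _).trans (mul_le_mul_of_nonneg_left ha (scalarNorm_nonneg α))
    · refine le_of_eq ?_
      linear_combination (scalarNorm α * scalarNorm β) * Real.mul_self_sqrt hC0
  refine ge_of_tendsto (x := nhdsWithin (0 : ℝ) (Set.Ioi 0))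
    (f := fun ε => scalarNorm α * (rowNrm N x + ε) * scalarNorm β) ?_
    (Filter.eventually_of_mem self_mem_nhdsWithin fun r hr => key r hr)
  have : Filter.Tendsto (fun ε : ℝ => scalarNorm α * (rowNrm N x + ε) * scalarNorm β) (nhds 0)
      (nhds (scalarNorm α * (rowNrm N x + 0) * scalarNorm β)) := Continuous.tendsto (by fun_prop) _
  rw [add_zero] at this
  exact this.mono_left nhdsWithin_le_nhds

theorem rowNrm_smul_le (c : ℂ) (x : Matrix m n (V × V)) :
    rowNrm N (c • x) ≤ ‖c‖ * rowNrm N x := by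
  classical
  have h : c • x = twoSided (c • (1 : Matrix m m ℂ)) x 1 := by rw [smul_twoSided, twoSided_one]
  rw [h]
  refine (rowNrm_twoSided_le _ _ _).trans ?_
  have h1 := (scalarNorm_smul_le c (1 : Matrix m m ℂ)).trans
    (mul_le_mul_of_nonneg_left scalarNorm_one_le (norm_nonneg c))
  rw [mul_one] at h1
  calc _ ≤ ‖c‖ * rowNrm N x * 1 := by
        refine mul_le_mul (mul_le_mul_of_nonneg_right h1 (rowNrm_nonneg x)) scalarNorm_one_le
          (scalarNorm_nonneg _) (mul_nonneg (norm_nonneg c) (rowNrm_nonneg x))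
    _ = _ := mul_one _

/-- The matrix norms of `R_2[V]`, with `e₁ ⊗ v₁ + e₂ ⊗ v₂` written as `(v₁, v₂)`. -/
def rowRuan (N : RuanNorm V) : RuanNorm (V × V) where
  nrm x := rowNrm N x
  nonneg := rowNrm_nonneg
  add_le := rowNrm_add_le
  smul_le := rowNrm_smul_le
  twoSided_le := rowNrm_twoSided_le
  fromBlocks_le := rowNrm_fromBlocks_le

/-- The amplification `1 ⊗ w`. -/
def diagAmpl (p : Type) [DecidableEq p] (w : Matrix k l V) : Matrix (p × k) (p × l) V :=
  of fun a b => if a.1 = b.1 then w a.2 b.2 else 0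

/-- Induction on the size of `p`: 1 ⊗ w is an iterated direct sum of copies of w. -/
theorem nrm_diagAmpl_le (p : Type) [Fintype p] [DecidableEq p] (w : Matrix k l V) :
    N.nrm (diagAmpl p w) ≤ N.nrm w := by
  suffices h : ∀ (p : Type) [Fintype p], ∀ [DecidableEq p], N.nrm (diagAmpl p w) ≤ N.nrm w from h p
  refine Fintype.induction_empty_option ?_ ?_ ?_
  · intro α β _ e h _
    let := Fintype.ofEquiv β e.symm
    classical
    refine le_trans (le_of_eq ?_) h
    have : diagAmpl β w = (diagAmpl α w).submatrix (e.symm.prodCongr (Equiv.refl k))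
        (e.symm.prodCongr (Equiv.refl l)) := by
      ext a b
      simp [diagAmpl]
    rw [this, N.nrm_submatrix_equiv]
  · intro _
    have : diagAmpl PEmpty w = 0 := by
      ext a
      exact a.1.elim
    rw [this, N.nrm_zero]
    exact N.nonneg w
  · intro α _ h _
    classical
    let e : ∀ {q : Type}, Option α × q → (α × q) ⊕ q := fun a => match a with
      | (none, c) => Sum.inr c
      | (some b, c) => Sum.inl (b, c)
    have he : ∀ {q : Type}, Function.Injective (e (q := q)) := by
      rintro q ⟨_ | a, c⟩ ⟨_ | a', c'⟩ <;> simp [e]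
    have : diagAmpl (Option α) w = (fromBlocks (diagAmpl α w) 0 0 w).submatrix e e := by
      ext ⟨_ | a, c⟩ ⟨_ | a', c'⟩ <;> simp [diagAmpl, e]
    rw [this]
    exact (N.nrm_submatrix_le _ he he).trans ((N.fromBlocks_le _ _).trans (max_le h le_rfl))

/-- The element `e₁ ⊗ v₁ + e₂ ⊗ v₂` of `R_2[V]`. -/
def rowMk (V : Type*) [AddCommGroup V] [Module ℂ V] : V × V →ₗ[ℂ] RowProj 2 V :=
  TensorProduct.mk ℂ (Row 2 ℂ) V !![1, 0] ∘ₗ LinearMap.fst ℂ V V +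
    TensorProduct.mk ℂ (Row 2 ℂ) V !![0, 1] ∘ₗ LinearMap.snd ℂ V V

/-- The `s`-th component of an element of `R_2[V]`. -/
def rowComp (V : Type*) [AddCommGroup V] [Module ℂ V] (s : Fin 2) : RowProj 2 V →ₗ[ℂ] V :=
  TensorProduct.lid ℂ V ∘ₗ TensorProduct.map (entryLinearMap ℂ ℂ 0 s) LinearMap.id

theorem rowComp_tmul (s : Fin 2) (r : Row 2 ℂ) (v : V) : rowComp V s (r ⊗ₜ v) = r 0 s • v := by
  simp [rowComp]

/-- The s-th component of v ⊗ w is v_s ⊗ w = (v_s ⊗ 1)(1 ⊗ w), so the row factor can be absorbed in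
the left scalar matrix while the right one stays common to both components. -/
theorem map_eq_twoSided_of_rowMk {m n : Type} {p q : ℕ} {y : Matrix m n (V × V)}
    {α : Matrix m (Fin p × Fin q) ℂ} {v : Matrix (Fin p) (Fin p) (Row 2 ℂ)}
    {w : Matrix (Fin q) (Fin q) V} {β : Matrix (Fin p × Fin q) n ℂ}
    (h : y.map (rowMk V) = twoSided α (kroneckerMap (fun a b => a ⊗ₜ[ℂ] b) v w) β) (s : Fin 2)
    {π : V × V → V} (hπ : ∀ z, rowComp V s (rowMk V z) = π z) :
    y.map π = twoSided (α * ampl (Fin q) (v.map fun r => r 0 s)) (diagAmpl (Fin p) w) β := by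
  have h1 := congrArg (fun M => M.map (rowComp V s)) h
  simp only [twoSided_map] at h1
  have h2 : (y.map (rowMk V)).map (rowComp V s) = y.map π := by
    ext i j
    exact hπ _
  rw [← h2, h1]
  conv_rhs => rw [← Matrix.one_mul β, ← twoSided_twoSided]
  congr 1
  ext ⟨a, b⟩ ⟨c, d⟩
  rw [twoSided_apply, Finset.sum_eq_single (c, b), Finset.sum_eq_single (c, d)]
  · simp [rowComp_tmul, ampl, diagAmpl]
  · intro z _ hz
    simp [one_apply_ne hz]
  · simp
  · rintro ⟨e, f⟩ - hz
    refine Finset.sum_eq_zero fun z _ => ?_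
    by_cases hzc : z = (c, d)
    · subst hzc
      by_cases hbf : b = f
      · subst hbf
        have : e ≠ c := fun h => hz (by rw [h])
        simp [diagAmpl, this]
      · simp [ampl, hbf]
    · simp [one_apply_ne hzc]
  · simp

variable [MatrixNorms V]

theorem rowNrm_le_of_projective
    (hN : ∀ {m n : Type} [Fintype m] [Fintype n] (x : Matrix m n V), mnorm x = N.nrm x) {p q : ℕ}
    {y : Matrix m n (V × V)} {α : Matrix m (Fin p × Fin q) ℂ}
    {v : Matrix (Fin p) (Fin p) (Row 2 ℂ)} {w : Matrix (Fin q) (Fin q) V}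
    {β : Matrix (Fin p × Fin q) n ℂ}
    (h : y.map (rowMk V) = twoSided α (kroneckerMap (fun a b => a ⊗ₜ[ℂ] b) v w) β) :
    rowNrm N y ≤ scalarNorm α * mnorm v * mnorm w * scalarNorm β := by
  have h1 := map_eq_twoSided_of_rowMk h 0 (π := Prod.fst) fun z => by
    simp [rowMk, rowComp_tmul]
  have h2 := map_eq_twoSided_of_rowMk h 1 (π := Prod.snd) fun z => by
    simp [rowMk, rowComp_tmul]
  refine rowNrm_le h1 h2 ?_ ((nrm_diagAmpl_le (Fin p) w).trans (hN w).ge) le_rfl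
  rw [← mul_fromCols]
  refine (scalarNorm_mul_le _ _).trans (mul_le_mul_of_nonneg_left ?_ (scalarNorm_nonneg α))
  let e : Fin p × Fin q → (Fin p × Fin 1) × Fin q := fun a => ((a.1, 0), a.2)
  let f : (Fin p × Fin q) ⊕ (Fin p × Fin q) → (Fin p × Fin 2) × Fin q :=
    Sum.elim (fun a => ((a.1, 0), a.2)) (fun a => ((a.1, 1), a.2))
  have he : Function.Injective e := by
    rintro ⟨a, b⟩ ⟨a', b'⟩; simp [e]
  have hf : Function.Injective f := by
    rintro (⟨a, b⟩ | ⟨a, b⟩) (⟨a', b'⟩ | ⟨a', b'⟩) <;> simp [f]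
  -- [v₁ ⊗ 1 v₂ ⊗ 1] is v ⊗ 1 with v read as a scalar matrix and its indices rearranged; hence its
  -- norm is at most ‖v‖.
  have : fromCols (ampl (Fin q) (v.map fun r => r 0 0)) (ampl (Fin q) (v.map fun r => r 0 1)) =
      (ampl (Fin q) (comp _ _ _ _ ℂ v)).submatrix e f := by
    ext ⟨a, b⟩ (⟨c, d⟩ | ⟨c, d⟩) <;> simp [ampl, e, f]
  rw [this]
  exact (scalarNorm_submatrix_le _ he hf).trans (scalarNorm_ampl_le _)

/-- The products `‖α‖ ‖v‖ ‖w‖ ‖β‖` over all factorizations `u = α (v ⊗ w) β`. -/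
def projSet (u : Matrix m n (RowProj 2 V)) : Set ℝ :=
  {r : ℝ | ∃ (p q : ℕ) (α : Matrix m (Fin p × Fin q) ℂ) (v : Matrix (Fin p) (Fin p) (Row 2 ℂ))
    (w : Matrix (Fin q) (Fin q) V) (β : Matrix (Fin p × Fin q) n ℂ),
    u = twoSided α (kroneckerMap (fun a b => a ⊗ₜ[ℂ] b) v w) β ∧
    r = scalarNorm α * mnorm v * mnorm w * scalarNorm β}

theorem mnorm_rowProj_def (u : Matrix m n (RowProj 2 V)) : mnorm u = sInf (projSet u) := rfl

theorem exists_projective_le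
    (hN : ∀ {m n : Type} [Fintype m] [Fintype n] (x : Matrix m n V), mnorm x = N.nrm x)
    {y : Matrix m n (V × V)} {a₁ a₂ : Matrix m k ℂ} {w : Matrix k l V} {b : Matrix l n ℂ}
    (h₁ : y.map Prod.fst = twoSided a₁ w b) (h₂ : y.map Prod.snd = twoSided a₂ w b) :
    ∃ r ∈ projSet (y.map (rowMk V)),
      r ≤ scalarNorm (fromCols a₁ a₂) * N.nrm w * scalarNorm b := by
  set e := Fintype.equivFin (k ⊕ l)
  set w' := reindex e e (fromBlocks 0 w 0 0) with hw'
  -- The column with entries e₁, e₂, completed by a zero column since the projective norm requires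
  -- square factors. As a scalar matrix it merely selects coordinates, so its norm is at most 1.
  let v : Matrix (Fin 2) (Fin 2) (Row 2 ℂ) :=
    of fun s t => if t = 0 then of fun _ u => if u = s then 1 else 0 else 0
  let g : k ⊕ k → Fin 2 × Fin (Fintype.card (k ⊕ l)) :=
    Sum.elim (fun i => (0, e (Sum.inl i))) (fun i => (1, e (Sum.inl i)))
  let h : l → Fin 2 × Fin (Fintype.card (k ⊕ l)) := fun j => (0, e (Sum.inr j))
  have hg : Function.Injective g := by
    rintro (i | i) (j | j) <;> simp [g]
  have hh : Function.Injective h := by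
    intro i j; simp [h]
  have hv : mnorm v ≤ 1 := by
    have : comp (Fin 2) (Fin 2) (Fin 1) (Fin 2) ℂ v =
        sel fun a : Fin 2 × Fin 1 => ((0 : Fin 2), a.1) := by
      ext ⟨s, z⟩ ⟨t, u⟩
      by_cases ht : t = 0 <;> simp [v, sel, ht]
    change scalarNorm (comp (Fin 2) (Fin 2) (Fin 1) (Fin 2) ℂ v) ≤ 1
    rw [this]
    refine scalarNorm_sel_le ?_
    rintro ⟨s, z⟩ ⟨t, u⟩
    simpa using fun h => ⟨h, Subsingleton.elim z u⟩
  have hw : mnorm w' ≤ N.nrm w := by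
    rw [hN]
    exact (N.nrm_submatrix_equiv _ e.symm e.symm).trans_le (N.nrm_fromBlocks_corner_le w)
  have hfac : y.map (rowMk V) = twoSided (fromCols a₁ a₂ * sel g)
      (kroneckerMap (fun a b => a ⊗ₜ[ℂ] b) v w') ((sel h)ᵀ * b) := by
    have e1 : (kroneckerMap (fun a b => a ⊗ₜ[ℂ] b) v w').submatrix g h =
        fromRows (w.map (TensorProduct.mk ℂ (Row 2 ℂ) V !![1, 0]))
          (w.map (TensorProduct.mk ℂ (Row 2 ℂ) V !![0, 1])) := by
      have v0 : (of fun _ u => if u = 0 then 1 else 0 : Row 2 ℂ) = !![1, 0] := by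
        ext i j; fin_cases i; fin_cases j <;> simp
      have v1 : (of fun _ u => if u = 1 then 1 else 0 : Row 2 ℂ) = !![0, 1] := by
        ext i j; fin_cases i; fin_cases j <;> simp
      ext (i | i) j <;> simp [g, h, v, hw', v0, v1]
    rw [← twoSided_twoSided, twoSided_sel, e1, twoSided_fromRows, ← twoSided_map, ← twoSided_map,
      ← h₁, ← h₂]
    ext i j
    simp [rowMk]
  refine ⟨_, ⟨_, _, _, v, w', _, hfac, rfl⟩, ?_⟩
  · have h3 : scalarNorm (fromCols a₁ a₂ * sel g) ≤ scalarNorm (fromCols a₁ a₂) := by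
      refine (scalarNorm_mul_le _ _).trans ?_
      simpa using mul_le_mul_of_nonneg_left (scalarNorm_sel_le hg) (scalarNorm_nonneg _)
    have h4 : scalarNorm ((sel h)ᵀ * b) ≤ scalarNorm b := by
      refine (scalarNorm_mul_le _ _).trans ?_
      rw [scalarNorm_transpose]
      simpa using mul_le_mul_of_nonneg_right (scalarNorm_sel_le hh) (scalarNorm_nonneg b)
    have h5 : 0 ≤ mnorm v := scalarNorm_nonneg _
    have h6 : 0 ≤ mnorm w' := by rw [hN]; exact N.nonneg _
    have h7 := scalarNorm_nonneg (fromCols a₁ a₂)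
    calc _ ≤ scalarNorm (fromCols a₁ a₂) * 1 * N.nrm w * scalarNorm b := by
          refine mul_le_mul (mul_le_mul (mul_le_mul h3 hv h5 h7) hw h6 (by simpa using h7)) h4
            (scalarNorm_nonneg _) (mul_nonneg (by simpa using h7) (N.nonneg w))
      _ = _ := by rw [mul_one]

/-- The operator space projective tensor norm on `R_2[V]` in terms of one-sided factorizations. -/
theorem mnorm_rowMk
    (hN : ∀ {m n : Type} [Fintype m] [Fintype n] (x : Matrix m n V), mnorm x = N.nrm x)
    (y : Matrix m n (V × V)) : mnorm (y.map (rowMk V)) = (rowRuan N).nrm y := by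
  rw [mnorm_rowProj_def]
  refine le_antisymm ?_ ?_
  · refine le_csInf (rowSet_nonempty y) ?_
    rintro _ ⟨k, l, _, _, a₁, a₂, w, b, h₁, h₂, rfl⟩
    obtain ⟨r, hr, hle⟩ := exists_projective_le hN h₁ h₂
    refine (csInf_le ⟨0, ?_⟩ hr).trans hle
    rintro _ ⟨p, q, α, v, w, β, -, rfl⟩
    rw [hN]
    exact mul_nonneg (mul_nonneg (mul_nonneg (scalarNorm_nonneg _) (scalarNorm_nonneg _))
      (N.nonneg w)) (scalarNorm_nonneg _)
  · refine le_csInf ?_ ?_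
    · obtain ⟨_, k, l, _, _, a₁, a₂, w, b, h₁, h₂, rfl⟩ := rowSet_nonempty (N := N) y
      obtain ⟨r, hr, -⟩ := exists_projective_le hN h₁ h₂
      exact ⟨r, hr⟩
    · rintro _ ⟨p, q, α, v, w, β, h, rfl⟩
      exact rowNrm_le_of_projective hN h

end RowNorm

theorem le_mul_of_forall_gt {t r K : ℝ} (h : ∀ C, r < C → t ≤ C * K) : t ≤ r * K := by
  refine ge_of_tendsto (x := nhdsWithin r (Set.Ioi r)) (f := fun C => C * K) ?_
    (Filter.eventually_of_mem self_mem_nhdsWithin fun C hC => h C hC)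
  exact (Continuous.tendsto (by fun_prop) _).mono_left nhdsWithin_le_nhds

/-! ### The two kinds of projection as one-sided estimates. -/

section Projections

variable {V : Type*} [AddCommGroup V] [Module ℂ V]
variable {m n k l : Type} [Fintype m] [Fintype n] [Fintype k] [Fintype l]

/-- `x ↦ [P x; Q x]` is a complete contraction of `V` into `C_2(V)`. -/
def ColIn (N : RuanNorm V) (P Q : V →ₗ[ℂ] V) : Prop :=
  ∀ ⦃m n : Type⦄ [Fintype m] [Fintype n] (x : Matrix m n V),
    N.nrm (fromRows (x.map P) (x.map Q)) ≤ N.nrm x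

/-- `[x; y] ↦ P x + Q y` is a complete contraction of `C_2(V)` into `V`. -/
def ColOut (N : RuanNorm V) (P Q : V →ₗ[ℂ] V) : Prop :=
  ∀ ⦃m n : Type⦄ [Fintype m] [Fintype n] (x y : Matrix m n V),
    N.nrm (x.map P + y.map Q) ≤ N.nrm (fromRows x y)

/-- `x ↦ [P x  Q x]` is a complete contraction of `V` into `R_2[V]`. -/
def RowIn (N : RuanNorm V) (P Q : V →ₗ[ℂ] V) : Prop :=
  ∀ ⦃m n : Type⦄ [Fintype m] [Fintype n] (x : Matrix m n V),
    (rowRuan N).nrm (x.map (P.prod Q)) ≤ N.nrm x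

/-- The square matrix over `Fin r` with corner `x`. -/
def pad (x : Matrix m n V) :
    Matrix (Fin (Fintype.card (m ⊕ n))) (Fin (Fintype.card (m ⊕ n))) V :=
  reindex (Fintype.equivFin (m ⊕ n)) (Fintype.equivFin (m ⊕ n)) (fromBlocks 0 x 0 0)

theorem pad_map {W : Type*} [AddCommGroup W] [Module ℂ W] (T : V →ₗ[ℂ] W) (x : Matrix m n V) :
    (pad x).map T = pad (x.map T) := by
  ext i j
  obtain ⟨i, rfl⟩ := (Fintype.equivFin (m ⊕ n)).surjective i
  obtain ⟨j, rfl⟩ := (Fintype.equivFin (m ⊕ n)).surjective j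
  rcases i with i | i <;> rcases j with j | j <;> simp [pad]

theorem nrm_pad (N : RuanNorm V) (x : Matrix m n V) : N.nrm (pad x) = N.nrm x := by
  rw [pad, reindex_apply, N.nrm_submatrix_equiv]
  refine le_antisymm (N.nrm_fromBlocks_corner_le x) ?_
  exact N.nrm_submatrix_le (fromBlocks (0 : Matrix m m V) x (0 : Matrix n m V) 0)
    Sum.inl_injective Sum.inr_injective

theorem nrm_fromRows_pad (N : RuanNorm V) (x y : Matrix m n V) :
    N.nrm (fromRows (pad x) (pad y)) = N.nrm (fromRows x y) := by
  set e := Fintype.equivFin (m ⊕ n)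
  refine le_antisymm ?_ ?_
  · have h : fromRows (pad x) (pad y) =
        (fromBlocks (0 : Matrix (m ⊕ m) m V) (fromRows x y) (0 : Matrix (n ⊕ n) m V) 0).submatrix
          ((Equiv.sumCongr e.symm e.symm).trans (Equiv.sumSumSumComm m n m n)) e.symm := by
      ext (i | i) j <;> obtain ⟨i, rfl⟩ := e.surjective i <;> obtain ⟨j, rfl⟩ := e.surjective j <;>
        rcases i with i | i <;> rcases j with j | j <;> simp [pad, e]
    rw [h, N.nrm_submatrix_equiv]
    exact N.nrm_fromBlocks_corner_le _
  · have h : fromRows x y = (fromRows (pad x) (pad y)).submatrix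
        (Sum.map (e ∘ Sum.inl) (e ∘ Sum.inl)) (e ∘ Sum.inr) := by
      ext (i | i) j <;> simp [pad, e]
    rw [h]
    exact N.nrm_submatrix_le _ ((e.injective.comp Sum.inl_injective).sumMap
      (e.injective.comp Sum.inl_injective)) (e.injective.comp Sum.inr_injective)

theorem isCompleteLeftMProjection_iff [MatrixNorms V] {N : RuanNorm V}
    (hN : ∀ {m n : Type} [Fintype m] [Fintype n] (x : Matrix m n V), mnorm x = N.nrm x)
    {P : V →ₗ[ℂ] V} (hP : P ∘ₗ P = P) :
    IsCompleteLeftMProjection P ↔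
      ColIn N P (LinearMap.id - P) ∧ ColOut N P (LinearMap.id - P) := by
  set Q : V →ₗ[ℂ] V := LinearMap.id - P with hQ
  have hPP : ∀ v, P (P v) = P v := fun v => LinearMap.congr_fun hP v
  have helem : ∀ {r : ℕ} (x : Matrix (Fin r) (Fin r) V), elemNorm x = N.nrm x := by
    intro r x
    change mnorm (comp (Fin 1) (Fin 1) (Fin r) (Fin r) V (of fun _ _ => x)) = _
    rw [hN, ← N.nrm_submatrix_equiv x (Equiv.uniqueProd (Fin r) (Fin 1))
      (Equiv.uniqueProd (Fin r) (Fin 1))]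
    rfl
  have hcol : ∀ {r : ℕ} (x : Matrix (Fin r) (Fin r) V),
      elemNorm (!![(P.mapMatrix x : Matrix (Fin r) (Fin r) V); x - P.mapMatrix x] :
        Col 2 (Matrix (Fin r) (Fin r) V)) = N.nrm (fromRows (x.map P) (x.map Q)) := by
    intro r x
    change mnorm (comp _ _ (Fin r) (Fin r) V (comp (Fin 1) (Fin 1) (Fin 2) (Fin 1) _
      (of fun _ _ => !![P.mapMatrix x; x - P.mapMatrix x]))) = _
    rw [hN]
    let e : (Fin 1 × Fin 2) × Fin r → Fin r ⊕ Fin r := fun a =>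
      if a.1.2 = 0 then Sum.inl a.2 else Sum.inr a.2
    let e' : Fin r ⊕ Fin r → (Fin 1 × Fin 2) × Fin r :=
      Sum.elim (fun i => ((0, 0), i)) (fun i => ((0, 1), i))
    let E : (Fin 1 × Fin 2) × Fin r ≃ Fin r ⊕ Fin r :=
      ⟨e, e', by rintro ⟨⟨a, b⟩, c⟩; fin_cases a; fin_cases b <;> simp [e, e'],
        by rintro (a | a) <;> simp [e, e']⟩
    let G : (Fin 1 × Fin 1) × Fin r ≃ Fin r := ⟨fun a => a.2, fun c => ((0, 0), c),
      fun a => Prod.ext (Subsingleton.elim _ _) rfl, fun _ => rfl⟩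
    rw [← N.nrm_submatrix_equiv _ E G]
    congr 1
    ext ⟨⟨a, b⟩, c⟩ ⟨⟨a', b'⟩, c'⟩
    fin_cases a
    fin_cases a'
    fin_cases b'
    fin_cases b <;> simp [E, e, G, hQ]
  constructor
  · intro h
    have heq : ∀ {m n : Type} [Fintype m] [Fintype n] (x : Matrix m n V),
        N.nrm x = N.nrm (fromRows (x.map P) (x.map Q)) := by
      intro m n _ _ x
      have h1 := (h _).2 (pad x)
      rw [helem, hcol, pad_map, pad_map, nrm_pad, nrm_fromRows_pad] at h1
      exact h1
    refine ⟨fun m n _ _ x => (heq x).ge, fun m n _ _ x y => ?_⟩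
    -- For z = Px + Qy one has Pz = Px and Qz = Qy, so ‖z‖ = ‖[Px; Qy]‖, and this column is part of
    -- the one formed from P and Q applied to [x; y].
    have h1 : (x.map P + y.map Q).map P = x.map P := by
      ext i j
      simp [hQ, hPP]
    have h2 : (x.map P + y.map Q).map Q = y.map Q := by
      ext i j
      simp [hQ, hPP]
    rw [heq (x.map P + y.map Q), h1, h2, heq (fromRows x y)]
    have h3 : fromRows (x.map P) (y.map Q) =
        (fromRows ((fromRows x y).map P) ((fromRows x y).map Q)).submatrix
          (Sum.map Sum.inl Sum.inr) id := by
      ext (i | i) j <;> simp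
    rw [h3]
    exact N.nrm_submatrix_le _ (Sum.inl_injective.sumMap Sum.inr_injective) Function.injective_id
  · rintro ⟨h1, h2⟩ r
    refine ⟨?_, fun x => ?_⟩
    · ext x i j
      simp [hPP]
    · rw [helem, hcol]
      refine le_antisymm ?_ (h1 x)
      refine le_trans (le_of_eq ?_) (h2 (x.map P) (x.map Q))
      congr 1
      ext i j
      simp [hQ, hPP]

theorem isCompleteRightLProjection_iff [MatrixNorms V] {N : RuanNorm V}
    (hN : ∀ {m n : Type} [Fintype m] [Fintype n] (x : Matrix m n V), mnorm x = N.nrm x)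
    {P : V →ₗ[ℂ] V} (hP : P ∘ₗ P = P) :
    IsCompleteRightLProjection P ↔
      ColIn N P (LinearMap.id - P) ∧ RowIn N P (LinearMap.id - P) := by
  classical
  set Q : V →ₗ[ℂ] V := LinearMap.id - P with hQ
  have hPP : ∀ v, P (P v) = P v := fun v => LinearMap.congr_fun hP v
  have hnu : ∀ {r : ℕ} (x : Matrix (Fin r) (Fin r) V),
      mnorm ((nuRow P).mapMatrix x) = (rowRuan N).nrm (x.map (P.prod Q)) := by
    intro r x
    rw [← mnorm_rowMk hN]
    rfl
  constructor
  · rintro ⟨-, h⟩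
    have heq : ∀ {m n : Type} [Fintype m] [Fintype n] (x : Matrix m n V),
        (rowRuan N).nrm (x.map (P.prod Q)) = N.nrm x := by
      intro m n _ _ x
      have h1 := h _ (pad x)
      rw [hnu, hN, pad_map, nrm_pad, nrm_pad] at h1
      exact h1
    refine ⟨fun m n _ _ x => ?_, fun m n _ _ x => (heq x).le⟩
    rw [← heq (fromRows (x.map P) (x.map Q)), ← mul_one (N.nrm x)]
    refine le_mul_of_forall_gt fun C hC => ?_
    rw [← heq x] at hC
    have hC0 : 0 ≤ C := ((rowRuan N).nonneg _).trans hC.le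
    obtain ⟨k, l, _, _, a₁, a₂, w, b, h₁, h₂, ha, hw, hb⟩ := exists_of_rowNrm_lt hC
    have h₁' : x.map P = twoSided a₁ w b := h₁
    have h₂' : x.map Q = twoSided a₂ w b := h₂
    have hz : ∀ a : Matrix m k ℂ, a = 0 → twoSided a w b = 0 := by
      rintro _ rfl
      ext i j
      simp [twoSided_apply]
    have hrows : ∀ a a' : Matrix m k ℂ, twoSided (fromRows a a') w b =
        fromRows (twoSided a w b) (twoSided a' w b) := by
      intro a a'
      ext (i | i) j <;> rfl
    -- If Px = a₁wb and Qx = a₂wb, the column [Px; Qx] has components [a₁; 0]wb and [0; a₂]wb. The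
    -- row of these two coefficients is a₁ ⊕ a₂, whose norm does not exceed that of [a₁ a₂].
    have hmain := rowNrm_le (N := N)
      (x := (fromRows (x.map P) (x.map Q)).map (P.prod Q)) (a₁ := fromRows a₁ 0)
      (a₂ := fromRows 0 a₂) (w := w) (b := b) (A := √C) ?_ ?_ ?_ hw hb
    · rwa [mul_one, Real.mul_self_sqrt hC0, ← mul_one C] at hmain
    · rw [hrows, hz 0 rfl, ← h₁']
      ext (i | i) j <;> simp [hQ, hPP]
    · rw [hrows, hz 0 rfl, ← h₂']
      ext (i | i) j <;> simp [hQ, hPP]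
    · have h3 : fromCols (fromRows a₁ (0 : Matrix m k ℂ)) (fromRows (0 : Matrix m k ℂ) a₂) =
          fromBlocks a₁ 0 0 a₂ := by
        ext (i | i) (j | j) <;> rfl
      rw [h3]
      refine scalarNorm_fromBlocks_le ?_ ?_
      · exact (scalarNorm_submatrix_le (fromCols a₁ a₂) Function.injective_id
          Sum.inl_injective).trans ha
      · exact (scalarNorm_submatrix_le (fromCols a₁ a₂) Function.injective_id
          Sum.inr_injective).trans ha
  · rintro ⟨h1, h2⟩
    refine ⟨hP, fun r x => ?_⟩
    rw [hnu, hN]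
    refine le_antisymm (h2 x) (le_csInf (rowSet_nonempty _) ?_)
    rintro _ ⟨k, l, _, _, a₁, a₂, w, b, h₁, h₂, rfl⟩
    have h₁' : x.map P = twoSided a₁ w b := h₁
    have h₂' : x.map Q = twoSided a₂ w b := h₂
    -- Idempotence gives Px = P(Px) = a₁ (Pw) b, and likewise for Q; thus any factorization of [Px
    -- Qx] presents x as [a₁ a₂][Pw; Qw]b, where `ColIn` bounds the middle.
    have hx : x = twoSided (fromCols a₁ a₂) (fromRows (w.map P) (w.map Q)) b := by
      rw [twoSided_fromRows, ← twoSided_map, ← twoSided_map, ← h₁', ← h₂']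
      ext i j
      simp [hQ, hPP]
    conv_lhs => rw [hx]
    refine (N.twoSided_le _ _ _).trans ?_
    exact mul_le_mul_of_nonneg_right (mul_le_mul_of_nonneg_left (h1 w) (scalarNorm_nonneg _))
      (scalarNorm_nonneg _)

/-- A completely contractive matrix of functionals on `R_2[V]` is a completely contractive column
of matrices of functionals on `V`. -/
theorem cbBound_fromRows_of_rowRuan {N : RuanNorm V}
    {h : Matrix m n (Module.Dual ℂ (V × V))} (hh : (rowRuan N).CBBound h 1) :
    N.CBBound (fromRows (h.map fun φ => φ ∘ₗ LinearMap.inl ℂ V V)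
      (h.map fun φ => φ ∘ₗ LinearMap.inr ℂ V V)) 1 := by
  classical
  intro k l _ _ α x β
  -- The column [(x, 0); (0, x)] factors with [a₁ a₂] equal to the identity, so its norm is at most
  -- ‖x‖. Pairing it with h tests both components at once.
  set y : Matrix (k ⊕ k) l (V × V) := fromRows (x.map fun v => (v, 0)) (x.map fun v => (0, v))
    with hy
  have hpair : pair (fromRows (h.map fun φ => φ ∘ₗ LinearMap.inl ℂ V V)
      (h.map fun φ => φ ∘ₗ LinearMap.inr ℂ V V)) (twoSided α x β) =
      pair h (twoSided (fromCols α.toRows₁ α.toRows₂) y β) := by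
    have e1 : twoSided α x β = fromRows (twoSided α.toRows₁ x β) (twoSided α.toRows₂ x β) := by
      ext (i | i) j <;> rfl
    have e2 : ∀ a : Matrix m k ℂ, twoSided a (x.map fun v => (v, (0 : V))) β =
        (twoSided a x β).map fun v => (v, 0) := fun a =>
      (twoSided_map (LinearMap.inl ℂ V V) a x β).symm
    have e3 : ∀ a : Matrix m k ℂ, twoSided a (x.map fun v => ((0 : V), v)) β =
        (twoSided a x β).map fun v => (0, v) := fun a =>
      (twoSided_map (LinearMap.inr ℂ V V) a x β).symm
    rw [e1, pair_fromRows, hy, twoSided_fromRows, pair_add, e2, e3]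
    rfl
  have hnorm : (rowRuan N).nrm y ≤ N.nrm x := by
    have h1 := rowNrm_le (N := N) (x := y) (a₁ := fromRows 1 0) (a₂ := fromRows 0 1) (w := x)
      (b := 1) (A := 1) (W := N.nrm x) (B := 1) ?_ ?_ ?_ le_rfl scalarNorm_one_le
    · rw [one_mul, mul_one] at h1
      exact h1
    · ext (i | i) j
      · exact (congrFun (congrFun (twoSided_one x) i) j).symm
      · simp [hy, twoSided_apply]
    · ext (i | i) j
      · simp [hy, twoSided_apply]
      · exact (congrFun (congrFun (twoSided_one x) i) j).symm
    · have h3 : fromCols (fromRows (1 : Matrix k k ℂ) (0 : Matrix k k ℂ))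
          (fromRows (0 : Matrix k k ℂ) (1 : Matrix k k ℂ)) = 1 := by
        rw [← fromBlocks_one]
        ext (i | i) (j | j) <;> rfl
      rw [h3]
      exact scalarNorm_one_le
  have hhs : hsNorm (fromCols α.toRows₁ α.toRows₂) = hsNorm α := by
    refine (sq_eq_sq₀ (hsNorm_nonneg _) (hsNorm_nonneg _)).1 ?_
    rw [hsNorm_fromCols_sq, ← hsNorm_fromRows_sq, fromRows_toRows]
  rw [hpair]
  refine (hh _ _ _).trans ?_
  rw [hhs, one_mul, one_mul]
  exact mul_le_mul_of_nonneg_right (mul_le_mul_of_nonneg_left hnorm (hsNorm_nonneg _))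
    (hsNorm_nonneg _)

theorem pair_prod (h : Matrix m n (Module.Dual ℂ (V × V))) (y : Matrix m n (V × V)) :
    pair h y = pair (fromRows (h.map fun φ => φ ∘ₗ LinearMap.inl ℂ V V)
      (h.map fun φ => φ ∘ₗ LinearMap.inr ℂ V V))
        (fromRows (y.map Prod.fst) (y.map Prod.snd)) := by
  rw [pair_fromRows]
  simp only [pair, map_apply, LinearMap.comp_apply, ← Finset.sum_add_distrib, ← map_add]
  simp

end Projections

/-! ### Duality of the one-sided estimates. -/

section Duality

variable {m n k l : Type} [Fintype m] [Fintype n] [Fintype k] [Fintype l]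

theorem hsNorm_fromCols_eq_fromRows (A B : Matrix m n ℂ) :
    hsNorm (fromCols A B) = hsNorm (fromRows A B) := by
  refine (sq_eq_sq₀ (hsNorm_nonneg _) (hsNorm_nonneg _)).1 ?_
  rw [hsNorm_fromCols_sq, ← hsNorm_fromRows_sq]

theorem RuanNorm.exists_cb_factorization_of_le {V : Type*} [AddCommGroup V] [Module ℂ V]
    (N : RuanNorm V) {F : Matrix k l V →ₗ[ℂ] ℂ} {K C : ℝ} (hK : 0 ≤ K)
    (hF : ∀ x, ‖F x‖ ≤ K * N.nrm x) (hC : K < C) :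
    ∃ (g : Matrix k l (Module.Dual ℂ V)) (a : Matrix k k ℂ) (b : Matrix l l ℂ),
      N.CBBound g 1 ∧ hsNorm a * hsNorm b ≤ C ∧ ∀ x, F x = pair g (twoSided a x b) := by
  obtain ⟨L, hKL, hLC⟩ := exists_between hC
  have hL : 0 < L := hK.trans_lt hKL
  obtain ⟨g, a, b, hg, hab, hfac⟩ := N.exists_cb_factorization (F := ((L⁻¹ : ℝ) : ℂ) • F)
    (fun x => by
      rw [LinearMap.smul_apply, norm_smul, Complex.norm_real,
        Real.norm_of_nonneg (inv_nonneg.2 hL.le), inv_mul_le_iff₀ hL]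
      exact (hF x).trans (mul_le_mul_of_nonneg_right hKL.le (N.nonneg x)))
    -- `F` is divided by an L strictly between `K` and `C`, so that 1 + ε becomes C / L.
    (ε := C / L - 1) (by rw [sub_pos, one_lt_div hL]; exact hLC)
  refine ⟨g, (L : ℂ) • a, b, hg, ?_, fun x => ?_⟩
  · rw [hsNorm_smul, Complex.norm_real, Real.norm_of_nonneg hL.le, mul_assoc, mul_comm,
      ← le_div_iff₀ hL]
    linarith
  · rw [smul_twoSided, pair_smul, ← hfac, LinearMap.smul_apply, smul_eq_mul, ← mul_assoc,
      ← Complex.ofReal_mul, mul_inv_cancel₀ hL.ne', Complex.ofReal_one, one_mul]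

variable {X : Type*} [NormedAddCommGroup X] [NormedSpace ℂ X]

theorem pair_toAlg_adjointMap (P : X →L[ℂ] X) (f : Matrix m n (StrongDual ℂ X))
    (x : Matrix m n X) :
    pair (toAlg (f.map (adjointMap P))) x = pair (toAlg f) (x.map (P : X →ₗ[ℂ] X)) := rfl

theorem toAlg_injective_of_pair {f g : Matrix m n (StrongDual ℂ X)}
    (h : ∀ x, pair (toAlg f) x = pair (toAlg g) x) : f = g := by
  classical
  have hs : ∀ (f : Matrix m n (StrongDual ℂ X)) i j x, pair (toAlg f) (single i j x) = f i j x := by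
    intro f i j x
    rw [pair, Finset.sum_eq_single i, Finset.sum_eq_single j]
    · simp [toAlg]
    · intro b _ hb
      simp [hb.symm]
    · simp
    · intro b _ hb
      exact Finset.sum_eq_zero fun c _ => by simp [hb.symm]
    · simp
  ext i j x
  rw [← hs f, ← hs g, h]

theorem toAlg_fromRows {m n k : Type} (f : Matrix m n (StrongDual ℂ X))
    (g : Matrix k n (StrongDual ℂ X)) :
    toAlg (fromRows f g) = fromRows (toAlg f) (toAlg g) := by
  ext (i | i) j <;> rfl

theorem twoSided_eq_fromRows {m n : Type} {V : Type*} [AddCommGroup V] [Module ℂ V]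
    (α : Matrix (m ⊕ m) k ℂ) (x : Matrix k l V) (β : Matrix l n ℂ) :
    twoSided α x β = fromRows (twoSided α.toRows₁ x β) (twoSided α.toRows₂ x β) := by
  ext (i | i) j <;> rfl

theorem adjointMap_idem {P : X →ₗ[ℂ] X} (hP : P ∘ₗ P = P) (hc : Continuous P) :
    adjointMap ⟨P, hc⟩ ∘ₗ adjointMap ⟨P, hc⟩ = adjointMap ⟨P, hc⟩ := by
  ext f x
  exact congrArg f (LinearMap.congr_fun hP x)

theorem adjointMap_id_sub (P : X →L[ℂ] X) :
    adjointMap (ContinuousLinearMap.id ℂ X - P) = LinearMap.id - adjointMap P := by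
  ext f x
  simp [adjointMap]

variable [OperatorSpace X] {P Q : X →L[ℂ] X}

/-- A column α of coefficients against [P*f; Q*f] becomes a row of coefficients against [Px; Qx], of
the same Hilbert–Schmidt norm. -/
theorem ColIn.dual (h : ColIn (opRuan X) P Q) :
    ColIn (dualRuan X) (adjointMap P) (adjointMap Q) := by
  intro m n _ _ f
  refine (dualRuan_le_iff ((dualRuan X).nonneg f)).2 ?_
  intro k l _ _ α x β
  have e : pair (toAlg (fromRows (f.map (adjointMap P)) (f.map (adjointMap Q))))
      (twoSided α x β) = pair (toAlg f) (twoSided (fromCols α.toRows₁ α.toRows₂)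
        (fromRows (x.map (P : X →ₗ[ℂ] X)) (x.map (Q : X →ₗ[ℂ] X))) β) := by
    rw [toAlg_fromRows, twoSided_eq_fromRows, pair_fromRows, pair_toAlg_adjointMap,
      pair_toAlg_adjointMap, twoSided_map, twoSided_map, ← pair_add, twoSided_fromRows]
  rw [e]
  refine (cbBound_mnorm f _ _ _).trans ?_
  rw [hsNorm_fromCols_eq_fromRows, fromRows_toRows]
  refine mul_le_mul_of_nonneg_left ?_ ((dualRuan X).nonneg f)
  exact mul_le_mul_of_nonneg_right (mul_le_mul_of_nonneg_left (h x) (hsNorm_nonneg _))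
    (hsNorm_nonneg _)

theorem ColIn.of_dual (h : ColIn (dualRuan X) (adjointMap P) (adjointMap Q)) :
    ColIn (opRuan X) P Q := by
  intro m n _ _ x
  refine (opRuan X).nrm_le_of_forall_pair ((opRuan X).nonneg x) fun g hg α β => ?_
  obtain ⟨f, rfl⟩ := exists_toAlg_eq hg
  have hf := (h f).trans ((dualRuan_le_iff zero_le_one).2 hg)
  rw [dualRuan_le_iff zero_le_one] at hf
  have e : pair (toAlg f) (twoSided α
      (fromRows (x.map (P : X →ₗ[ℂ] X)) (x.map (Q : X →ₗ[ℂ] X))) β) =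
      pair (toAlg (fromRows (f.map (adjointMap P)) (f.map (adjointMap Q))))
        (twoSided (fromRows α.toCols₁ α.toCols₂) x β) := by
    have e1 : twoSided (fromRows α.toCols₁ α.toCols₂) x β =
        fromRows (twoSided α.toCols₁ x β) (twoSided α.toCols₂ x β) := by
      ext (i | i) j <;> rfl
    rw [toAlg_fromRows, e1, pair_fromRows, pair_toAlg_adjointMap,
      pair_toAlg_adjointMap, twoSided_map, twoSided_map, ← pair_add, ← twoSided_fromRows,
      fromCols_toCols]
  rw [e]
  refine (hf _ _ _).trans (le_of_eq ?_)
  rw [← hsNorm_fromCols_eq_fromRows, fromCols_toCols]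
  ring

/-- Completely contractive functionals on R_2[X*] are columns H over X**, which need not come from
X. The remedy is to view the column [αP*fβ; αQ*fβ] as a functional on matrices over X: `ColOut`
bounds it, and factoring it through a completely contractive g over X* makes the bound on H
applicable. -/
theorem ColOut.dual (h : ColOut (opRuan X) P Q) :
    RowIn (dualRuan X) (adjointMap P) (adjointMap Q) := by
  intro m n _ _ f
  refine (rowRuan (dualRuan X)).nrm_le_of_forall_pair ((dualRuan X).nonneg f) fun h' hh' α β => ?_
  have hcb := cbBound_fromRows_of_rowRuan hh'
  rw [pair_prod]
  set H := fromRows (h'.map fun φ => φ ∘ₗ LinearMap.inl ℂ (StrongDual ℂ X) (StrongDual ℂ X))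
    (h'.map fun φ => φ ∘ₗ LinearMap.inr ℂ (StrongDual ℂ X) (StrongDual ℂ X))
  have e1 : (twoSided α (f.map ((adjointMap P).prod (adjointMap Q))) β).map Prod.fst =
      twoSided α (f.map (adjointMap P)) β :=
    twoSided_map (LinearMap.fst ℂ (StrongDual ℂ X) (StrongDual ℂ X)) α _ β
  have e2 : (twoSided α (f.map ((adjointMap P).prod (adjointMap Q))) β).map Prod.snd =
      twoSided α (f.map (adjointMap Q)) β :=
    twoSided_map (LinearMap.snd ℂ (StrongDual ℂ X) (StrongDual ℂ X)) α _ β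
  rw [e1, e2]
  set f' := fromRows (twoSided α (f.map (adjointMap P)) β) (twoSided α (f.map (adjointMap Q)) β)
    with hf'
  let F : Matrix (m ⊕ m) n X →ₗ[ℂ] ℂ :=
    { toFun := fun x => pair (toAlg f') x
      map_add' := fun x y => pair_add _ x y
      map_smul' := fun c x => pair_smul c _ x }
  have hFeq : ∀ x, F x = pair (toAlg f') x := fun _ => rfl
  have hF : ∀ x, ‖F x‖ ≤ (dualRuan X).nrm f * (hsNorm α * hsNorm β) * (opRuan X).nrm x := by
    intro x
    have e3 : F x = pair (toAlg f) (twoSided αᵀ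
        (x.toRows₁.map (P : X →ₗ[ℂ] X) + x.toRows₂.map (Q : X →ₗ[ℂ] X)) βᵀ) := by
      have e4 : ∀ (T : X →L[ℂ] X) (z : Matrix m n X),
          pair (toAlg (twoSided α (f.map (adjointMap T)) β)) z =
            pair (toAlg f) (twoSided αᵀ (z.map (T : X →ₗ[ℂ] X)) βᵀ) := by
        intro T z
        rw [← twoSided_map, pair_toAlg_adjointMap, toAlg_twoSided, pair_twoSided,
          transpose_transpose, transpose_transpose]
      rw [hFeq, hf', toAlg_fromRows, ← fromRows_toRows x, pair_fromRows, e4, e4, twoSided_add,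
        pair_add, toRows₁_fromRows, toRows₂_fromRows]
    rw [e3]
    refine (cbBound_mnorm f _ _ _).trans ?_
    have h1 := h x.toRows₁ x.toRows₂
    rw [fromRows_toRows] at h1
    rw [hsNorm_transpose, hsNorm_transpose]
    calc _ ≤ mnorm f * (hsNorm α * (opRuan X).nrm x * hsNorm β) :=
          mul_le_mul_of_nonneg_left (mul_le_mul_of_nonneg_right
            (mul_le_mul_of_nonneg_left h1 (hsNorm_nonneg _)) (hsNorm_nonneg _))
            ((dualRuan X).nonneg f)
      _ = _ := by rw [← mnorm_eq_dualRuan]; ring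
  have hK : 0 ≤ (dualRuan X).nrm f * (hsNorm α * hsNorm β) :=
    mul_nonneg ((dualRuan X).nonneg f) (mul_nonneg (hsNorm_nonneg _) (hsNorm_nonneg _))
  refine le_of_forall_gt_imp_ge_of_dense fun C hC => ?_
  obtain ⟨g, a, b, hg, hab, hfac⟩ := (opRuan X).exists_cb_factorization_of_le hK hF hC
  obtain ⟨g, rfl⟩ := exists_toAlg_eq hg
  have hg1 : (dualRuan X).nrm g ≤ 1 := (dualRuan_le_iff zero_le_one).2 hg
  -- This equality lives over X*, so H can now be evaluated on it, with a and b as Hilbert–Schmidt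
  -- factors.
  have e5 : f' = twoSided aᵀ g bᵀ := toAlg_injective_of_pair fun x => by
    rw [← hFeq, hfac, pair_twoSided, toAlg_twoSided]
  rw [e5]
  refine (hcb _ _ _).trans ?_
  rw [hsNorm_transpose, hsNorm_transpose, one_mul]
  calc _ ≤ hsNorm a * 1 * hsNorm b :=
        mul_le_mul_of_nonneg_right (mul_le_mul_of_nonneg_left hg1 (hsNorm_nonneg _))
          (hsNorm_nonneg _)
    _ ≤ C := by rwa [mul_one]

/-- A factorization P*f = a₁wb, Q*f = a₂wb turns ⟨f, α(Px + Qy)β⟩ into a pairing of w with [x; y],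
with coefficients [a₁ᵀα a₂ᵀα] and βbᵀ. -/
theorem ColOut.of_dual (h : RowIn (dualRuan X) (adjointMap P) (adjointMap Q)) :
    ColOut (opRuan X) P Q := by
  intro m n _ _ x y
  refine (opRuan X).nrm_le_of_forall_pair ((opRuan X).nonneg _) fun g hg α β => ?_
  obtain ⟨f, rfl⟩ := exists_toAlg_eq hg
  have hf := (h f).trans ((dualRuan_le_iff zero_le_one).2 hg)
  rw [← one_mul ((opRuan X).nrm _ * _)]
  refine le_mul_of_forall_gt fun C hC => ?_
  have hC0 : 0 ≤ C := zero_le_one.trans hC.le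
  obtain ⟨k, l, _, _, a₁, a₂, w, b, h₁, h₂, ha, hw, hb⟩ := exists_of_rowNrm_lt (hf.trans_lt hC)
  have h₁' : f.map (adjointMap P) = twoSided a₁ w b := h₁
  have h₂' : f.map (adjointMap Q) = twoSided a₂ w b := h₂
  have e : pair (toAlg f) (twoSided α (x.map (P : X →ₗ[ℂ] X) + y.map (Q : X →ₗ[ℂ] X)) β) =
      pair (toAlg w) (twoSided (fromCols (a₁ᵀ * α) (a₂ᵀ * α)) (fromRows x y) (β * bᵀ)) := by
    have e4 : ∀ (T : X →L[ℂ] X) (a : Matrix m k ℂ) (z : Matrix m n X),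
        f.map (adjointMap T) = twoSided a w b →
        pair (toAlg f) (twoSided α (z.map (T : X →ₗ[ℂ] X)) β) =
          pair (toAlg w) (twoSided (aᵀ * α) z (β * bᵀ)) := by
      intro T a z hT
      rw [← twoSided_map, ← pair_toAlg_adjointMap, hT, toAlg_twoSided, ← twoSided_twoSided,
        pair_twoSided (toAlg w), transpose_transpose, transpose_transpose]
    rw [twoSided_add, pair_add, e4 P a₁ x h₁', e4 Q a₂ y h₂', ← pair_add, twoSided_fromRows]
  have ha' : hsNorm (fromCols (a₁ᵀ * α) (a₂ᵀ * α)) ≤ √C * hsNorm α := by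
    rw [hsNorm_fromCols_eq_fromRows, ← fromRows_mul, ← transpose_fromCols]
    refine (hsNorm_mul_le _ _).trans ?_
    rw [scalarNorm_transpose]
    exact mul_le_mul_of_nonneg_right ha (hsNorm_nonneg _)
  have hb' : hsNorm (β * bᵀ) ≤ hsNorm β * √C := by
    refine (hsNorm_mul_le' _ _).trans ?_
    rw [scalarNorm_transpose]
    exact mul_le_mul_of_nonneg_left hb (hsNorm_nonneg _)
  have hw' := (dualRuan_le_iff zero_le_one).1 hw
  have hnn := (opRuan X).nonneg (fromRows x y)
  rw [e]
  refine (hw' _ _ _).trans ?_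
  rw [one_mul]
  calc _ ≤ (√C * hsNorm α) * (opRuan X).nrm (fromRows x y) * (hsNorm β * √C) :=
        mul_le_mul (mul_le_mul_of_nonneg_right ha' hnn) hb' (hsNorm_nonneg _)
          (mul_nonneg (mul_nonneg (Real.sqrt_nonneg _) (hsNorm_nonneg _)) hnn)
    _ = _ := by
      linear_combination (hsNorm α * (opRuan X).nrm (fromRows x y) * hsNorm β) *
        Real.mul_self_sqrt hC0

/-- A factorization of [Px Qx] moves a₁ and a₂ onto the column [f; g], which is then paired with the
single matrix w. -/
theorem RowIn.dual (h : RowIn (opRuan X) P Q) :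
    ColOut (dualRuan X) (adjointMap P) (adjointMap Q) := by
  intro m n _ _ f g
  refine (dualRuan_le_iff ((dualRuan X).nonneg _)).2 ?_
  intro p q _ _ α x β
  have hD := (dualRuan X).nonneg (fromRows f g)
  rw [show (dualRuan X).nrm (fromRows f g) * (hsNorm α * (opRuan X).nrm x * hsNorm β) =
    (opRuan X).nrm x * ((dualRuan X).nrm (fromRows f g) * (hsNorm α * hsNorm β)) by ring]
  refine le_mul_of_forall_gt fun C hC => ?_
  have hC0 : 0 ≤ C := ((opRuan X).nonneg x).trans hC.le
  obtain ⟨k, l, _, _, a₁, a₂, w, b, h₁, h₂, ha, hw, hb⟩ :=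
    exists_of_rowNrm_lt ((h x).trans_lt hC)
  have h₁' : x.map (P : X →ₗ[ℂ] X) = twoSided a₁ w b := h₁
  have h₂' : x.map (Q : X →ₗ[ℂ] X) = twoSided a₂ w b := h₂
  have e : pair (toAlg (f.map (adjointMap P) + g.map (adjointMap Q))) (twoSided α x β) =
      pair (toAlg (fromRows f g)) (twoSided (fromRows (α * a₁) (α * a₂)) w (b * β)) := by
    have e0 : toAlg (f.map (adjointMap P) + g.map (adjointMap Q)) =
        toAlg (f.map (adjointMap P)) + toAlg (g.map (adjointMap Q)) := rfl
    have e1 : twoSided (fromRows (α * a₁) (α * a₂)) w (b * β) =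
        fromRows (twoSided (α * a₁) w (b * β)) (twoSided (α * a₂) w (b * β)) := by
      ext (i | i) j <;> rfl
    rw [e0, add_pair, pair_toAlg_adjointMap, pair_toAlg_adjointMap, twoSided_map, twoSided_map,
      h₁', h₂', twoSided_twoSided, twoSided_twoSided, toAlg_fromRows, e1, pair_fromRows]
  have ha' : hsNorm (fromRows (α * a₁) (α * a₂)) ≤ hsNorm α * √C := by
    rw [← hsNorm_fromCols_eq_fromRows, ← mul_fromCols]
    exact (hsNorm_mul_le' _ _).trans (mul_le_mul_of_nonneg_left ha (hsNorm_nonneg _))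
  have hb' : hsNorm (b * β) ≤ √C * hsNorm β :=
    (hsNorm_mul_le _ _).trans (mul_le_mul_of_nonneg_right hb (hsNorm_nonneg _))
  rw [e]
  refine (cbBound_mnorm (fromRows f g) _ _ _).trans ?_
  rw [mnorm_eq_dualRuan]
  calc _ ≤ (dualRuan X).nrm (fromRows f g) * ((hsNorm α * √C) * 1 * (√C * hsNorm β)) := by
        refine mul_le_mul_of_nonneg_left ?_ hD
        have h3 := mul_nonneg (hsNorm_nonneg α) (Real.sqrt_nonneg C)
        exact mul_le_mul (mul_le_mul ha' hw ((opRuan X).nonneg w) h3) hb' (hsNorm_nonneg _)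
          (by simpa using h3)
    _ = _ := by
      linear_combination ((dualRuan X).nrm (fromRows f g) * hsNorm α * hsNorm β) *
        Real.mul_self_sqrt hC0

/-- A functional testing R_2[X] is a contractive column over X* itself, so `ColOut` for the adjoints
applies directly and no factorization is needed. -/
theorem RowIn.of_dual (h : ColOut (dualRuan X) (adjointMap P) (adjointMap Q)) :
    RowIn (opRuan X) P Q := by
  intro m n _ _ x
  refine (rowRuan (opRuan X)).nrm_le_of_forall_pair ((opRuan X).nonneg x) fun h' hh' α β => ?_
  have hcb := cbBound_fromRows_of_rowRuan hh'
  rw [pair_prod]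
  obtain ⟨f, hf⟩ := exists_toAlg_eq hcb
  rw [← hf] at hcb ⊢
  have e1 : (twoSided α (x.map ((P : X →ₗ[ℂ] X).prod (Q : X →ₗ[ℂ] X))) β).map Prod.fst =
      twoSided α (x.map (P : X →ₗ[ℂ] X)) β :=
    twoSided_map (LinearMap.fst ℂ X X) α _ β
  have e2 : (twoSided α (x.map ((P : X →ₗ[ℂ] X).prod (Q : X →ₗ[ℂ] X))) β).map Prod.snd =
      twoSided α (x.map (Q : X →ₗ[ℂ] X)) β :=
    twoSided_map (LinearMap.snd ℂ X X) α _ β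
  rw [e1, e2]
  have h1 := h f.toRows₁ f.toRows₂
  rw [fromRows_toRows] at h1
  have h2 := (dualRuan_le_iff zero_le_one).1
    (h1.trans ((dualRuan_le_iff zero_le_one).2 hcb)) α x β
  have e3 : toAlg (f.toRows₁.map (adjointMap P) + f.toRows₂.map (adjointMap Q)) =
      toAlg (f.toRows₁.map (adjointMap P)) + toAlg (f.toRows₂.map (adjointMap Q)) := rfl
  rw [e3, add_pair, pair_toAlg_adjointMap, pair_toAlg_adjointMap, twoSided_map,
    twoSided_map] at h2
  rw [← fromRows_toRows f, toAlg_fromRows, pair_fromRows]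
  refine h2.trans (le_of_eq ?_)
  ring

/-- The 1 × 1 case, keeping only the upper entry of the column; this supplies the boundedness
asserted in both equivalences. -/
theorem ColIn.continuous {P Q : X →ₗ[ℂ] X} (h : ColIn (opRuan X) P Q) : Continuous P := by
  refine (P.mkContinuous 1 fun x => ?_).continuous
  rw [one_mul, ← opRuan_singleton, ← opRuan_singleton]
  refine le_trans ?_ (h (of fun _ _ : Fin 1 => x))
  exact (opRuan X).nrm_submatrix_le (fromRows ((of fun _ _ : Fin 1 => x).map P)
    ((of fun _ _ : Fin 1 => x).map Q)) Sum.inl_injective Function.injective_id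

theorem leftM_iff_dual (P : X →L[ℂ] X) :
    ColIn (opRuan X) P (LinearMap.id - (P : X →ₗ[ℂ] X)) ∧
        ColOut (opRuan X) P (LinearMap.id - (P : X →ₗ[ℂ] X)) ↔
      ColIn (dualRuan X) (adjointMap P) (LinearMap.id - adjointMap P) ∧
        RowIn (dualRuan X) (adjointMap P) (LinearMap.id - adjointMap P) := by
  have h : LinearMap.id - (P : X →ₗ[ℂ] X) =
    ((ContinuousLinearMap.id ℂ X - P : X →L[ℂ] X) : X →ₗ[ℂ] X) := rfl
  rw [h, ← adjointMap_id_sub]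
  exact ⟨fun h => ⟨h.1.dual, h.2.dual⟩, fun h => ⟨.of_dual h.1, .of_dual h.2⟩⟩

theorem rightL_iff_dual (P : X →L[ℂ] X) :
    ColIn (opRuan X) P (LinearMap.id - (P : X →ₗ[ℂ] X)) ∧
        RowIn (opRuan X) P (LinearMap.id - (P : X →ₗ[ℂ] X)) ↔
      ColIn (dualRuan X) (adjointMap P) (LinearMap.id - adjointMap P) ∧
        ColOut (dualRuan X) (adjointMap P) (LinearMap.id - adjointMap P) := by
  have h : LinearMap.id - (P : X →ₗ[ℂ] X) =
    ((ContinuousLinearMap.id ℂ X - P : X →L[ℂ] X) : X →ₗ[ℂ] X) := rfl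
  rw [h, ← adjointMap_id_sub]
  exact ⟨fun h => ⟨h.1.dual, h.2.dual⟩, fun h => ⟨.of_dual h.1, .of_dual h.2⟩⟩

end Duality

end OpSp

end

theorem corollary3p5 {X : Type*} [NormedAddCommGroup X] [NormedSpace ℂ X] [OpSp.OperatorSpace X]
    (P : X →ₗ[ℂ] X) (hP : P ∘ₗ P = P) :
    (OpSp.IsCompleteLeftMProjection P ↔
      ∃ hc : Continuous P, OpSp.IsCompleteRightLProjection (OpSp.adjointMap ⟨P, hc⟩)) ∧
    (OpSp.IsCompleteRightLProjection P ↔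
      ∃ hc : Continuous P, OpSp.IsCompleteLeftMProjection (OpSp.adjointMap ⟨P, hc⟩)) := by
  have hN := fun {m n : Type} [Fintype m] [Fintype n] (x : Matrix m n X) =>
    OpSp.mnorm_eq_opRuan x
  have hD := fun {m n : Type} [Fintype m] [Fintype n] (f : Matrix m n (StrongDual ℂ X)) =>
    OpSp.mnorm_eq_dualRuan f
  rw [OpSp.isCompleteLeftMProjection_iff hN hP, OpSp.isCompleteRightLProjection_iff hN hP]
  constructor
  · refine ⟨fun h => ⟨h.1.continuous, ?_⟩, fun ⟨hc, h⟩ => ?_⟩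
    · rw [OpSp.isCompleteRightLProjection_iff hD (OpSp.adjointMap_idem hP _)]
      exact (OpSp.leftM_iff_dual ⟨P, _⟩).1 h
    · rw [OpSp.isCompleteRightLProjection_iff hD (OpSp.adjointMap_idem hP hc)] at h
      exact (OpSp.leftM_iff_dual ⟨P, hc⟩).2 h
  · refine ⟨fun h => ⟨h.1.continuous, ?_⟩, fun ⟨hc, h⟩ => ?_⟩
    · rw [OpSp.isCompleteLeftMProjection_iff hD (OpSp.adjointMap_idem hP _)]
      exact (OpSp.rightL_iff_dual ⟨P, _⟩).1 h
    · rw [OpSp.isCompleteLeftMProjection_iff hD (OpSp.adjointMap_idem hP hc)] at h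
      exact (OpSp.rightL_iff_dual ⟨P, hc⟩).2 h
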